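/- Let $U(\epsilon)$, $0\le\epsilon\le 1/2$, be a family of $n\times n$ unitary matrices whose characteristic polynomial $\det(\lambda-U(\epsilon))$ is a polynomial in both $\lambda$ and $\epsilon$ (for quantum walks on a star with $N$ edges, $\epsilon=1/N$). Then there are $\delta\in(0,1/2]$ and finitely many functions $a_1,\dots,a_p$ and $b_{i,k}$ ($1\le i\le q$, $k\in\{0,1\}$) on $[0,\delta)$, given there by convergent series $$a_i(\epsilon)=\sum_{j\ge0}A_{i,j}\,\epsilon^j,\qquad b_{i,k}(\epsilon)=\sum_{j\ge0}(-1)^{kj}B_{i,j}\,(\sqrt\epsilon)^j ,$$ where for each $i$ some $B_{i,j}$ with $j$ odd is nonzero, such that for all $\epsilon\in[0,\delta)$ $$\det(\lambda-U(\epsilon))=\prod_{i=1}^p(\lambda-a_i(\epsilon))\prod_{i=1}^q(\lambda-b_{i,0}(\epsilon))(\lambda-b_{i,1}(\epsilon)).$$ Every eigenvalue $\lambda(\epsilon)$ of $U(\epsilon)$ that is chosen continuously on an interval $[0,\eta]$, with $0<\eta\le1/2$, coincides near $\epsilon=0$ with one of the functions $a_i$ or $b_{i,k}$. The second form occurs only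 at degenerate eigenvalues: each $b_{i,k}(0)$ is an eigenvalue of $U(0)$ of multiplicity at least $2$. In particular this holds for the scattering walk on a star with $N$ edges, with hub amplitudes $-r$ (reflection) and $t$ (transmission), where $t=2/N$ and $r=1-t$, with leaves $2,\dots,N$ that reflect with a phase $e^{i\phi}$, and with a finite graph $G$ attached at vertex $1$ whose vertices act by arbitrary unitary scattering matrices. Here $U(\epsilon)$ is the matrix of the walk in the basis $|{\rm in}\rangle=\frac1{\sqrt{N-1}}\sum_{j=2}^N|j,0\rangle$, $|{\rm out}\rangle=\frac1{\sqrt{N-1}}\sum_{j=2}^N|0,j\rangle$, $|0,1\rangle$, $|1,0\rangle$ and the directed edges of $G$, with $$U(\epsilon)|{\rm in}\rangle=(1-2\epsilon)|{\rm out}\rangle+2\sqrt{\epsilon-\epsilon^2}\,|0,1\rangle,\quad U(\epsilon)|1,0\rangle=-(1-2\epsilon)|0,1\rangle+2\sqrt{\epsilon-\epsilon^2}\,|{\rm out}\rangle,\quad U(\epsilon)|{\rm out}\rangle=e^{i\phi}|{\rm in}\rangle .$$ For every $N\ge2$ the matrix $U(1/N)$ is the restriction of the $N$-edge walk to the span of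 this orthonormal basis; $U(\epsilon)$ is unitary for $0\le\epsilon\le1/2$, and its characteristic polynomial is a polynomial in $\lambda$ and $\epsilon$. -/

import Mathlib

open scoped Polynomial Matrix

noncomputable section

/-- `f` is the sum of the convergent power series `∑ A j * ε ^ j` for `0 ≤ ε < δ`. -/
def HasEpsExpansion (A : ℕ → ℂ) (δ : ℝ) (f : ℝ → ℂ) : Prop :=
  ∀ ε : ℝ, 0 ≤ ε → ε < δ → HasSum (fun j : ℕ => A j * (ε : ℂ) ^ j) (f ε)

/-- `f` is the sum of the convergent series `∑ (-1) ^ (k j) * A j * (√ε) ^ j` for `0 ≤ ε < δ`. -/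
def HasSqrtExpansion (k : Fin 2) (A : ℕ → ℂ) (δ : ℝ) (f : ℝ → ℂ) : Prop :=
  ∀ ε : ℝ, 0 ≤ ε → ε < δ →
    HasSum (fun j : ℕ => (-1 : ℂ) ^ ((k : ℕ) * j) * A j * ((Real.sqrt ε : ℝ) : ℂ) ^ j) (f ε)

/-- The characteristic polynomial of `U ε` is, for `0 ≤ ε ≤ 1/2`, a polynomial in both the
spectral variable and `ε`: the outer variable of `P` is the spectral one, the inner one is `ε`. -/
def HasPolynomialCharpoly {ι : Type*} [Fintype ι] [DecidableEq ι]
    (U : ℝ → Matrix ι ι ℂ) : Prop :=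
  ∃ P : ℂ[X][X], ∀ ε : ℝ, 0 ≤ ε → ε ≤ 1 / 2 →
    (U ε).charpoly = P.map (Polynomial.evalRingHom (ε : ℂ))

/-- The functions `a i` (with coefficients `A i`) and the pairs `b i 0`, `b i 1` (with
coefficients `B i`) form a complete list of the eigenvalues of `U ε` for `0 ≤ ε < δ`. -/
structure IsEigenvalueExpansion {ι : Type*} [Fintype ι] [DecidableEq ι]
    (U : ℝ → Matrix ι ι ℂ) (δ : ℝ) {p q : ℕ}
    (A : Fin p → ℕ → ℂ) (a : Fin p → ℝ → ℂ)
    (B : Fin q → ℕ → ℂ) (b : Fin q → Fin 2 → ℝ → ℂ) : Prop where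
  /-- the `a i` are power series in `ε` -/
  eps : ∀ i, HasEpsExpansion (A i) δ (a i)
  /-- the `b i 0` and `b i 1` are series in `√ε`, with the same coefficients up to `(-1) ^ j` -/
  sqrt : ∀ i k, HasSqrtExpansion k (B i) δ (b i k)
  /-- the series for `b i k` really involves `√ε` -/
  sqrt_proper : ∀ i, ∃ j, Odd j ∧ B i j ≠ 0
  /-- `√ε` occurs only at eigenvalues that are degenerate at `ε = 0` -/
  degenerate : ∀ i k, 2 ≤ (U 0).charpoly.rootMultiplicity (b i k 0)
  /-- these are all the eigenvalues, with their algebraic multiplicities -/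
  complete : ∀ ε : ℝ, 0 ≤ ε → ε < δ →
    (U ε).charpoly =
      (∏ i, (Polynomial.X - Polynomial.C (a i ε))) *
        ∏ i, ∏ k, (Polynomial.X - Polynomial.C (b i k ε))
  /-- every continuous choice of an eigenvalue follows a single one of these functions
  near `ε = 0` -/
  continuous_choice : ∀ (η : ℝ) (f : ℝ → ℂ), 0 < η → η ≤ 1 / 2 →
    ContinuousOn f (Set.Icc 0 η) →
    (∀ ε ∈ Set.Icc 0 η, Module.End.HasEigenvalue (Matrix.toLin' (U ε)) (f ε)) →
    ∃ δ' : ℝ, 0 < δ' ∧ δ' ≤ δ ∧ δ' ≤ η ∧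
      ((∃ i, ∀ ε : ℝ, 0 ≤ ε → ε < δ' → f ε = a i ε) ∨
        (∃ i k, ∀ ε : ℝ, 0 ≤ ε → ε < δ' → f ε = b i k ε))

/-- Near `ε = 0` every eigenvalue of `U ε` is a power series in `ε` or one of a pair of
series in `√ε`, the latter only at degenerate eigenvalues of `U 0`. -/
def EigenvaluesExpand {ι : Type*} [Fintype ι] [DecidableEq ι] (U : ℝ → Matrix ι ι ℂ) : Prop :=
  ∃ δ : ℝ, 0 < δ ∧ δ ≤ 1 / 2 ∧ ∃ (p q : ℕ)
    (A : Fin p → ℕ → ℂ) (a : Fin p → ℝ → ℂ)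
    (B : Fin q → ℕ → ℂ) (b : Fin q → Fin 2 → ℝ → ℂ),
    IsEigenvalueExpansion U δ A a B b

/-- The directed edges of a star with hub `0`, with leaves indexed by `L`, and with one more
edge from the hub to a vertex `1` of a graph whose directed edges are indexed by `D`. -/
inductive StarArc (L D : Type*) where
  /-- the state `|j, 0⟩` -/
  | inn (j : L)
  /-- the state `|0, j⟩` -/
  | out (j : L)
  /-- the state `|0, 1⟩` -/
  | toG
  /-- the state `|1, 0⟩` -/
  | fromG
  /-- the directed edge `d` of the attached graph -/
  | dart (d : D)
  deriving DecidableEq, Fintype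

/-- The vertex that an arc of the right side enters: `none` is `|0, 1⟩`. -/
def arcHead {V : Type*} {G : SimpleGraph V} (v₁ : V) : Option G.Dart → V
  | none => v₁
  | some d => d.snd

/-- The vertex that an arc of the right side leaves: `none` is `|1, 0⟩`. -/
def arcTail {V : Type*} {G : SimpleGraph V} (v₁ : V) : Option G.Dart → V
  | none => v₁
  | some d => d.fst

/-- The scattering at the vertices of the graph `G`, which is attached to the hub at `v₁`.
`S o i` is the amplitude from the arc `i` entering a vertex of `G` to the arc `o` leaving it.
As `S` vanishes unless `i` enters the vertex that `o` leaves, `S` is the direct sum of one matrix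
for each vertex, and it is unitary if and only if all of these are. -/
structure Scattering {V : Type*} [Fintype V] [DecidableEq V] (G : SimpleGraph V)
    [DecidableRel G.Adj] (v₁ : V) where
  S : Matrix (Option G.Dart) (Option G.Dart) ℂ
  unitary : S ∈ Matrix.unitaryGroup (Option G.Dart) ℂ
  isLocal : ∀ o i, arcTail v₁ o ≠ arcHead v₁ i → S o i = 0

/-- One step of the scattering walk (rows: final state, columns: initial state). The hub acts by
`H`, whose index `none` stands for the edge to vertex `1`; the leaves reflect with the phase
`exp (i φ)`; the vertices of the attached graph act by `S`. -/
def starStep {L D : Type*} [DecidableEq L] (H : Matrix (Option L) (Option L) ℂ) (φ : ℝ)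
    (S : Matrix (Option D) (Option D) ℂ) : Matrix (StarArc L D) (StarArc L D) ℂ
  | .out k, .inn j => H (some k) (some j)
  | .toG, .inn j => H none (some j)
  | .out k, .fromG => H (some k) none
  | .toG, .fromG => H none none
  | .inn k, .out j => if k = j then Complex.exp (Complex.I * (φ : ℂ)) else 0
  | .fromG, .toG => S none none
  | .dart d, .toG => S (some d) none
  | .fromG, .dart d => S none (some d)
  | .dart d', .dart d => S (some d') (some d)
  | _, _ => 0

/-- The hub of a star with `m + 1` edges: reflection `-r`, transmission `t`, where
`t = 2 / (m + 1)` and `r = 1 - t`. -/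
def groverHub (m : ℕ) : Matrix (Option (Fin m)) (Option (Fin m)) ℂ := fun k j =>
  if k = j then -(1 - 2 / ((m : ℂ) + 1)) else 2 / ((m : ℂ) + 1)

/-- The hub in the basis `|in⟩, |out⟩, |0, 1⟩, |1, 0⟩`:
`|in⟩ ↦ (1 - 2ε)|out⟩ + 2√(ε - ε²)|0, 1⟩` and `|1, 0⟩ ↦ -(1 - 2ε)|0, 1⟩ + 2√(ε - ε²)|out⟩`. -/
def reducedHub (ε : ℝ) : Matrix (Option Unit) (Option Unit) ℂ
  | some _, some _ => ((1 - 2 * ε : ℝ) : ℂ)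
  | none, some _ => ((2 * Real.sqrt (ε - ε ^ 2) : ℝ) : ℂ)
  | some _, none => ((2 * Real.sqrt (ε - ε ^ 2) : ℝ) : ℂ)
  | none, none => ((-(1 - 2 * ε) : ℝ) : ℂ)

section

variable {V : Type*} [Fintype V] [DecidableEq V] {G : SimpleGraph V} [DecidableRel G.Adj] {v₁ : V}

/-- The walk on the star with `m + 1` edges, to one of which `G` is attached. -/
def fullWalk (W : Scattering G v₁) (φ : ℝ) (m : ℕ) :
    Matrix (StarArc (Fin m) G.Dart) (StarArc (Fin m) G.Dart) ℂ :=
  starStep (groverHub m) φ W.S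

/-- The matrix `U(ε)` of the walk in the basis `|in⟩`, `|out⟩`, `|0, 1⟩`, `|1, 0⟩` and the
directed edges of `G`. -/
def walkMatrix (W : Scattering G v₁) (φ : ℝ) (ε : ℝ) :
    Matrix (StarArc Unit G.Dart) (StarArc Unit G.Dart) ℂ :=
  starStep (reducedHub ε) φ W.S

end

/-- The embedding with `|in⟩ ↦ m^(-1/2) ∑ |j, 0⟩` and `|out⟩ ↦ m^(-1/2) ∑ |0, j⟩`, the identity on
the other basis states. -/
def symmetricEmbedding (m : ℕ) (D : Type*) [DecidableEq D] :
    Matrix (StarArc (Fin m) D) (StarArc Unit D) ℂ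
  | .inn _, .inn _ => (((Real.sqrt m)⁻¹ : ℝ) : ℂ)
  | .out _, .out _ => (((Real.sqrt m)⁻¹ : ℝ) : ℂ)
  | .toG, .toG => 1
  | .fromG, .fromG => 1
  | .dart d', .dart d => if d' = d then 1 else 0
  | _, _ => 0

end

/-! Put `s = √ε`. The characteristic polynomial of `U (s ^ 2)` extends to a family `F s` of monic
polynomials, analytic in complex `s` and even in `s`. For small real `s` of either sign its roots
lie on the unit circle. The core is a version of Rellich's theorem,
`IsAnalyticFamily.splitsAnalytically`: such a family has roots analytic in `s`, without further
fractional powers.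

The unit circle enters only through `HasConeRoots`: near each point the squared differences of roots
lie in a fixed convex cone. This condition passes to factors, to translates of the roots and to the
roots divided by `s`, so an induction on the degree works. If `F 0` has two distinct roots, Hensel's
lemma (`IsAnalyticFamily.exists_factorization`) splits `F`. Otherwise the roots are centred, so that
all of them tend to `0`. Their sum of squares is `-2` times the second coefficient and, the cone
being convex, it dominates every squared root. That coefficient lies in a cone for both `s` and
`-s`, so it cannot vanish to order one; hence it is `O(s ^ 2)` and all roots are `O(s)`. Dividing
the roots by `s` lowers its order of vanishing by two, so the process ends
(`IsAnalyticFamily.exists_eq_scaleRoots`).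

Since `F` is even, `s ↦ -s` permutes the root functions (`exists_even_and_pairs`). The even ones are
power series in `ε`; the others come in pairs `g s`, `g (-s)`, which meet at `s = 0`. A continuous
eigenvalue follows one branch because distinct analytic branches do not meet again near `0`.

For the star, unitarity comes from the block structure of a step, and a diagonal change of basis
removes the square root from the characteristic polynomial. -/

noncomputable section

open Filter Topology Polynomial

/-! ### Monic polynomials as coefficient vectors, and Hensel's lemma. -/

namespace Polynomial

/-- The polynomial of degree `< n` with the given coefficients. -/
def ofCoeffs {n : ℕ} (u : Fin n → ℂ) : ℂ[X] := ∑ i : Fin n, monomial (i : ℕ) (u i)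

/-- The monic polynomial of degree `n` with the given lower coefficients. -/
def monicOfCoeffs {n : ℕ} (u : Fin n → ℂ) : ℂ[X] := X ^ n + ofCoeffs u

lemma coeff_ofCoeffs {n : ℕ} (u : Fin n → ℂ) (k : ℕ) :
    (ofCoeffs u).coeff k = if h : k < n then u ⟨k, h⟩ else 0 := by
  simp only [ofCoeffs, finsetSum_coeff, coeff_monomial]
  split_ifs with h
  · rw [Finset.sum_eq_single ⟨k, h⟩] <;> simp +contextual [Fin.ext_iff]
  · refine Finset.sum_eq_zero fun i _ => if_neg ?_
    have := i.2
    omega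

lemma degree_ofCoeffs_lt {n : ℕ} (u : Fin n → ℂ) : (ofCoeffs u).degree < n := by
  rw [degree_lt_iff_coeff_zero]
  intro m hm
  rw [coeff_ofCoeffs, dif_neg (by omega)]

lemma ofCoeffs_add_smul {n : ℕ} (u v : Fin n → ℂ) (t : ℂ) :
    ofCoeffs (u + t • v) = ofCoeffs u + C t * ofCoeffs v := by
  ext k
  simp only [coeff_add, coeff_C_mul, coeff_ofCoeffs]
  split_ifs <;> simp

lemma ofCoeffs_eq_zero {n : ℕ} {u : Fin n → ℂ} (h : ofCoeffs u = 0) : u = 0 := by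
  ext i
  have := congrArg (fun p => coeff p (i : ℕ)) h
  simpa [coeff_ofCoeffs] using this

lemma monic_monicOfCoeffs {n : ℕ} (u : Fin n → ℂ) : (monicOfCoeffs u).Monic :=
  monic_X_pow_add (degree_ofCoeffs_lt u)

lemma natDegree_monicOfCoeffs {n : ℕ} (u : Fin n → ℂ) : (monicOfCoeffs u).natDegree = n := by
  rw [natDegree_eq_of_degree_eq_some]
  rw [monicOfCoeffs, degree_add_eq_left_of_degree_lt] <;> simp [degree_ofCoeffs_lt]

lemma Monic.eq_monicOfCoeffs {p : ℂ[X]} (hp : p.Monic) :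
    p = monicOfCoeffs (fun i : Fin p.natDegree => p.coeff i) := by
  ext k
  simp only [monicOfCoeffs, coeff_add, coeff_ofCoeffs, coeff_X_pow]
  rcases lt_trichotomy k p.natDegree with h | h | h
  · simp [h, h.ne]
  · simp [h, hp.coeff_natDegree]
  · rw [coeff_eq_zero_of_natDegree_lt h]
    simp [h.ne', h.not_gt]

lemma Monic.eq_of_coeff_eq {p q : ℂ[X]} {n : ℕ} (hp : p.Monic) (hq : q.Monic)
    (hpn : p.natDegree = n) (hqn : q.natDegree = n) (h : ∀ k < n, p.coeff k = q.coeff k) :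
    p = q := by
  ext k
  rcases lt_trichotomy k n with hk | hk | hk
  · exact h k hk
  · rw [hk, ← hpn, hp.coeff_natDegree, hpn, ← hqn, hq.coeff_natDegree]
  · rw [coeff_eq_zero_of_natDegree_lt (by omega), coeff_eq_zero_of_natDegree_lt (by omega)]

lemma contDiff_coeff_monicOfCoeffs {n : ℕ} (k : ℕ) (m : WithTop ℕ∞) :
    ContDiff ℂ m (fun u : Fin n → ℂ => (monicOfCoeffs u).coeff k) := by
  simp only [monicOfCoeffs, coeff_add, coeff_ofCoeffs]
  split_ifs <;> fun_prop

/-- Multiplication of monic polynomials in terms of lower coefficients. -/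
def mulCoeffs (a b : ℕ) (w : (Fin a → ℂ) × (Fin b → ℂ)) : Fin (a + b) → ℂ :=
  fun k => (monicOfCoeffs w.1 * monicOfCoeffs w.2).coeff k

lemma contDiff_mulCoeffs (a b : ℕ) (m : WithTop ℕ∞) : ContDiff ℂ m (mulCoeffs a b) := by
  refine contDiff_pi.2 fun k => ?_
  simp only [mulCoeffs, coeff_mul]
  refine ContDiff.sum fun x _ => ContDiff.mul ?_ ?_
  · exact (contDiff_coeff_monicOfCoeffs _ _).comp contDiff_fst
  · exact (contDiff_coeff_monicOfCoeffs _ _).comp contDiff_snd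

lemma fderiv_mulCoeffs (a b : ℕ) (w d : (Fin a → ℂ) × (Fin b → ℂ)) (k : Fin (a + b)) :
    fderiv ℂ (mulCoeffs a b) w d k =
      (ofCoeffs d.1 * monicOfCoeffs w.2 + monicOfCoeffs w.1 * ofCoeffs d.2).coeff k := by
  have hd : HasFDerivAt (mulCoeffs a b) (fderiv ℂ (mulCoeffs a b) w) (w + (0 : ℂ) • d) := by
    rw [zero_smul, add_zero]
    exact ((contDiff_mulCoeffs a b 1).differentiable (by norm_num) w).hasFDerivAt
  have hl : HasDerivAt (fun t : ℂ => w + t • d) d 0 := by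
    simpa using ((hasDerivAt_id (0 : ℂ)).smul_const d).const_add w
  have h1 := hasDerivAt_pi.1 (hd.comp_hasDerivAt (0 : ℂ) hl) k
  have h2 : HasDerivAt (fun t : ℂ => (monicOfCoeffs w.1 * monicOfCoeffs w.2).coeff k +
      t * (ofCoeffs d.1 * monicOfCoeffs w.2 + monicOfCoeffs w.1 * ofCoeffs d.2).coeff k +
      t ^ 2 * (ofCoeffs d.1 * ofCoeffs d.2).coeff k)
      ((ofCoeffs d.1 * monicOfCoeffs w.2 + monicOfCoeffs w.1 * ofCoeffs d.2).coeff k) 0 := by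
    have := (((hasDerivAt_id (0 : ℂ)).mul_const
      ((ofCoeffs d.1 * monicOfCoeffs w.2 + monicOfCoeffs w.1 * ofCoeffs d.2).coeff k)).const_add
      ((monicOfCoeffs w.1 * monicOfCoeffs w.2).coeff k)).add
      ((hasDerivAt_pow 2 (0 : ℂ)).mul_const ((ofCoeffs d.1 * ofCoeffs d.2).coeff k))
    exact this.congr_deriv (by simp)
  refine h1.unique (h2.congr_of_eventuallyEq (Eventually.of_forall fun t => ?_))
  simp only [Function.comp, mulCoeffs, monicOfCoeffs, Prod.fst_add, Prod.snd_add, Prod.smul_fst,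
    Prod.smul_snd, ofCoeffs_add_smul]
  rw [← coeff_C_mul, ← coeff_C_mul, ← coeff_add, ← coeff_add]
  congr 1
  simp only [C_pow]
  ring

/-- A kernel element satisfies `d₁ * q + p * d₂ = 0`. Coprimality gives `p ∣ d₁`, and `deg d₁ < deg
p` forces `d₁ = 0`, then `d₂ = 0`. Source and target both have dimension `a + b`, so the derivative
is invertible. -/
lemma fderiv_mulCoeffs_injective {a b : ℕ} (w : (Fin a → ℂ) × (Fin b → ℂ))
    (h : IsCoprime (monicOfCoeffs w.1) (monicOfCoeffs w.2)) :
    Function.Injective (fderiv ℂ (mulCoeffs a b) w) := by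
  rw [injective_iff_map_eq_zero]
  intro d hd
  have h0 : ofCoeffs d.1 * monicOfCoeffs w.2 + monicOfCoeffs w.1 * ofCoeffs d.2 = 0 := by
    ext k
    by_cases hk : k < a + b
    · have := congrFun hd ⟨k, hk⟩
      rwa [fderiv_mulCoeffs] at this
    · refine coeff_eq_zero_of_degree_lt (lt_of_lt_of_le ?_ (Nat.cast_le.2 (not_lt.1 hk)))
      refine lt_of_le_of_lt (degree_add_le _ _) (max_lt ?_ ?_)
      · rw [degree_mul, degree_eq_natDegree (monic_monicOfCoeffs w.2).ne_zero,
          natDegree_monicOfCoeffs, Nat.cast_add]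
        exact WithBot.add_lt_add_right (by simp) (degree_ofCoeffs_lt _)
      · rw [degree_mul, degree_eq_natDegree (monic_monicOfCoeffs w.1).ne_zero,
          natDegree_monicOfCoeffs, Nat.cast_add]
        exact WithBot.add_lt_add_left (by simp) (degree_ofCoeffs_lt _)
  have hdvd : monicOfCoeffs w.1 ∣ ofCoeffs d.1 := by
    refine h.dvd_of_dvd_mul_right ⟨-ofCoeffs d.2, ?_⟩
    rw [mul_neg]
    exact eq_neg_of_add_eq_zero_left h0
  have h1 : ofCoeffs d.1 = 0 := by
    refine eq_zero_of_dvd_of_degree_lt hdvd ?_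
    rw [degree_eq_natDegree (monic_monicOfCoeffs w.1).ne_zero, natDegree_monicOfCoeffs]
    exact degree_ofCoeffs_lt _
  have h2 : ofCoeffs d.2 = 0 := by
    rw [h1, zero_mul, zero_add] at h0
    exact (mul_eq_zero.1 h0).resolve_left (monic_monicOfCoeffs w.1).ne_zero
  exact Prod.ext (ofCoeffs_eq_zero h1) (ofCoeffs_eq_zero h2)

end Polynomial

/-- A family of monic polynomials of degree `n` with coefficients that are analytic at `0`. -/
structure IsAnalyticFamily (n : ℕ) (F : ℂ → ℂ[X]) : Prop where
  monic : ∀ s, (F s).Monic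
  natDegree : ∀ s, (F s).natDegree = n
  analyticAt : ∀ k, AnalyticAt ℂ (fun s => (F s).coeff k) 0

lemma isAnalyticFamily_monicOfCoeffs {n : ℕ} {u : ℂ → Fin n → ℂ} (hu : AnalyticAt ℂ u 0) :
    IsAnalyticFamily n (fun s => monicOfCoeffs (u s)) :=
  ⟨fun _ => monic_monicOfCoeffs _, fun _ => natDegree_monicOfCoeffs _, fun k =>
    AnalyticAt.comp (g := fun u : Fin n → ℂ => (monicOfCoeffs u).coeff k)
      (ContDiffAt.analyticAt (contDiff_coeff_monicOfCoeffs k _).contDiffAt) hu⟩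

/-- Hensel's lemma for analytic families. -/
lemma IsAnalyticFamily.exists_factorization {n : ℕ} {F : ℂ → ℂ[X]} (hF : IsAnalyticFamily n F)
    {p q : ℂ[X]} (hp : p.Monic) (hq : q.Monic) (hpq : IsCoprime p q) (h0 : F 0 = p * q) :
    ∃ G H : ℂ → ℂ[X], IsAnalyticFamily p.natDegree G ∧ IsAnalyticFamily q.natDegree H ∧
      ∀ᶠ s in 𝓝 0, F s = G s * H s := by
  set a := p.natDegree
  set b := q.natDegree
  have hn : n = a + b := by rw [← hF.natDegree 0, h0, hp.natDegree_mul hq]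
  subst hn
  set w : (Fin a → ℂ) × (Fin b → ℂ) := (fun i => p.coeff i, fun i => q.coeff i) with hw
  have hp' : monicOfCoeffs w.1 = p := hp.eq_monicOfCoeffs.symm
  have hq' : monicOfCoeffs w.2 = q := hq.eq_monicOfCoeffs.symm
  have hinj := fderiv_mulCoeffs_injective w (by rwa [hp', hq'])
  let e : ((Fin a → ℂ) × (Fin b → ℂ)) ≃L[ℂ] (Fin (a + b) → ℂ) :=
    (LinearEquiv.ofInjectiveOfFinrankEq (fderiv ℂ (mulCoeffs a b) w : _ →ₗ[ℂ] _) hinj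
      (by simp)).toContinuousLinearEquiv
  -- The smoothness exponent `⊤` stands for analyticity, so the local inverse is analytic as well.
  have hcd : ContDiffAt ℂ ⊤ (mulCoeffs a b) w := (contDiff_mulCoeffs a b _).contDiffAt
  have hd : HasFDerivAt (mulCoeffs a b) (e : _ →L[ℂ] _) w := by
    have : (e : _ →L[ℂ] _) = fderiv ℂ (mulCoeffs a b) w := by
      exact ContinuousLinearMap.ext fun _ => rfl
    rw [this]
    exact ((contDiff_mulCoeffs a b 1).differentiable (by norm_num) w).hasFDerivAt
  set g := hcd.localInverse hd (by simp)
  have hg : AnalyticAt ℂ g (mulCoeffs a b w) :=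
    ContDiffAt.analyticAt (hcd.to_localInverse hd (by simp))
  have hinv : ∀ᶠ y in 𝓝 (mulCoeffs a b w), mulCoeffs a b (g y) = y :=
    (hcd.hasStrictFDerivAt' hd (by simp)).eventually_right_inverse
  let c : ℂ → Fin (a + b) → ℂ := fun s k => (F s).coeff k
  have hc : AnalyticAt ℂ c 0 := analyticAt_pi_iff.2 fun k => hF.analyticAt k
  have hc0 : c 0 = mulCoeffs a b w := by
    funext k
    simp only [c, mulCoeffs, hp', hq', h0]
  have hgc : AnalyticAt ℂ (fun s => g (c s)) 0 := AnalyticAt.comp (by rwa [hc0]) hc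
  refine ⟨_, _, isAnalyticFamily_monicOfCoeffs (analyticAt_fst.comp hgc),
    isAnalyticFamily_monicOfCoeffs (analyticAt_snd.comp hgc), ?_⟩
  have ht : Tendsto c (𝓝 0) (𝓝 (mulCoeffs a b w)) := hc0 ▸ hc.continuousAt
  filter_upwards [ht.eventually hinv] with s hs
  refine Monic.eq_of_coeff_eq (hF.monic s) ((monic_monicOfCoeffs _).mul (monic_monicOfCoeffs _))
    (hF.natDegree s) ?_ fun k hk => ?_
  · rw [(monic_monicOfCoeffs _).natDegree_mul (monic_monicOfCoeffs _), natDegree_monicOfCoeffs,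
      natDegree_monicOfCoeffs]
  · exact (congrFun hs ⟨k, hk⟩).symm

/-! ### Analytic functions controlled along the real axis. -/

/-- The punctured neighbourhoods of `0` in the real line, as a filter on `ℂ`. -/
def realPunctured : Filter ℂ := map (fun t : ℝ => (t : ℂ)) (𝓝[≠] 0)

lemma realPunctured_le : realPunctured ≤ 𝓝[≠] (0 : ℂ) := by
  refine tendsto_nhdsWithin_iff.2 ⟨?_, ?_⟩
  · exact (Complex.continuous_ofReal.tendsto' 0 0 Complex.ofReal_zero).mono_left nhdsWithin_le_nhds
  · filter_upwards [self_mem_nhdsWithin] with t ht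
    simpa using ht

lemma realPunctured_le_nhds : realPunctured ≤ 𝓝 (0 : ℂ) := realPunctured_le.trans nhdsWithin_le_nhds

instance : realPunctured.NeBot := map_neBot

/-- Both signs of `s` are essential: the roots of `X ^ 2 - s` are real for `s > 0` but not analytic.
Comparing `s` with `-s` excludes such families. -/
lemma tendsto_neg_realPunctured : Tendsto (fun s : ℂ => -s) realPunctured realPunctured := by
  rw [realPunctured, tendsto_map'_iff]
  have h : Tendsto (fun t : ℝ => -t) (𝓝[≠] 0) (𝓝[≠] 0) := by
    refine tendsto_nhdsWithin_iff.2 ⟨?_, ?_⟩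
    · exact (continuous_neg.tendsto' (0 : ℝ) 0 neg_zero).mono_left nhdsWithin_le_nhds
    · filter_upwards [self_mem_nhdsWithin] with t ht
      simpa using ht
  have := (tendsto_map (f := fun t : ℝ => (t : ℂ))).comp h
  refine this.congr fun t => ?_
  simp

lemma eventually_realPunctured_exists :
    ∀ᶠ s in realPunctured, ∃ t : ℝ, t ≠ 0 ∧ s = (t : ℂ) := by
  rw [realPunctured, eventually_map]
  filter_upwards [self_mem_nhdsWithin] with t ht
  exact ⟨t, ht, rfl⟩

lemma AnalyticAt.eventually_eq_of_realPunctured {f g : ℂ → ℂ} (hf : AnalyticAt ℂ f 0)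
    (hg : AnalyticAt ℂ g 0) (h : ∀ᶠ s in realPunctured, f s = g s) : ∀ᶠ s in 𝓝 0, f s = g s :=
  (hf.frequently_eq_iff_eventually_eq hg).1 (h.frequently.filter_mono realPunctured_le)

lemma AnalyticAt.eventually_eq_zero_of_pow_mul {f : ℂ → ℂ} (hf : AnalyticAt ℂ f 0) (k : ℕ)
    (h : ∀ᶠ s in 𝓝 0, s ^ k * f s = 0) : ∀ᶠ s in 𝓝 0, f s = 0 := by
  refine (hf.frequently_eq_iff_eventually_eq (analyticAt_const (v := (0 : ℂ)))).1
    (Eventually.frequently ?_)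
  filter_upwards [h.filter_mono nhdsWithin_le_nhds, self_mem_nhdsWithin] with s hs h0
  exact (mul_eq_zero.1 hs).resolve_left (pow_ne_zero _ h0)

/-- The order of vanishing is visible on the real axis: after `m` factors `s` are extracted, the
bound makes the quotient tend to `0` along real `s`, so it vanishes at `0` and yields one more
factor. -/
lemma AnalyticAt.exists_eq_pow_mul_of_bound {f : ℂ → ℂ} (hf : AnalyticAt ℂ f 0) (m : ℕ) (K : ℝ)
    (h : ∀ᶠ s in realPunctured, ‖f s‖ ≤ K * ‖s‖ ^ m) :
    ∃ g : ℂ → ℂ, AnalyticAt ℂ g 0 ∧ ∀ᶠ s in 𝓝 0, f s = s ^ m * g s := by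
  induction m generalizing K with
  | zero => exact ⟨f, hf, by simp⟩
  | succ m ih =>
    obtain ⟨g, hg, hfg⟩ := ih |K| (by
      have h1 : ∀ᶠ s : ℂ in realPunctured, ‖s‖ ≤ 1 := by
        have : ∀ᶠ s : ℂ in 𝓝 0, ‖s‖ < 1 := by
          filter_upwards [Metric.ball_mem_nhds (0 : ℂ) one_pos] with s hs
          simpa using hs
        exact (this.filter_mono realPunctured_le_nhds).mono fun s hs => hs.le
      filter_upwards [h, h1] with s hs h1
      refine hs.trans ?_
      rw [pow_succ]
      have := le_abs_self K
      have h2 : 0 ≤ ‖s‖ ^ m := by positivity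
      calc K * (‖s‖ ^ m * ‖s‖) ≤ |K| * (‖s‖ ^ m * ‖s‖) := by gcongr
        _ ≤ |K| * (‖s‖ ^ m * 1) := by gcongr
        _ = _ := by ring)
    have hb : ∀ᶠ s in realPunctured, ‖g s‖ ≤ K * ‖s‖ := by
      filter_upwards [h, hfg.filter_mono realPunctured_le_nhds,
        realPunctured_le self_mem_nhdsWithin] with s hs hs' h0
      have h0' : 0 < ‖s‖ ^ m := pow_pos (norm_pos_iff.2 h0) _
      rw [hs', norm_mul, norm_pow, pow_succ] at hs
      refine le_of_mul_le_mul_left (hs.trans_eq ?_) h0'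
      ring
    have hg0 : g 0 = 0 := by
      have h1 : Tendsto (fun s => ‖g s‖) realPunctured (𝓝 ‖g 0‖) :=
        (hg.continuousAt.tendsto.norm).mono_left realPunctured_le_nhds
      have h2 : Tendsto (fun s : ℂ => K * ‖s‖) realPunctured (𝓝 0) := by
        have : Tendsto (fun s : ℂ => K * ‖s‖) (𝓝 0) (𝓝 0) := by
          have : Continuous (fun s : ℂ => K * ‖s‖) := by fun_prop
          exact this.tendsto' 0 0 (by simp)
        exact this.mono_left realPunctured_le_nhds
      exact norm_le_zero_iff.1 (le_of_tendsto_of_tendsto h1 h2 hb)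
    have hord : ((1 : ℕ) : ℕ∞) ≤ analyticOrderAt g 0 := by
      rw [Nat.cast_one, Order.one_le_iff_ne_zero]
      exact analyticOrderAt_ne_zero.2 ⟨hg, hg0⟩
    obtain ⟨g', hg', hgg'⟩ := (natCast_le_analyticOrderAt hg).1 hord
    refine ⟨g', hg', ?_⟩
    filter_upwards [hfg, hgg'] with s h1 h2
    rw [h1, h2]
    simp
    ring

lemma IsAnalyticFamily.eventually_eq_of_realPunctured {n : ℕ} {F G : ℂ → ℂ[X]}
    (hF : IsAnalyticFamily n F) (hG : IsAnalyticFamily n G)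
    (h : ∀ᶠ s in realPunctured, F s = G s) : ∀ᶠ s in 𝓝 0, F s = G s := by
  have : ∀ᶠ s in 𝓝 0, ∀ k ∈ Finset.range n, (F s).coeff k = (G s).coeff k := by
    rw [eventually_all_finset]
    intro k _
    exact (hF.analyticAt k).eventually_eq_of_realPunctured (hG.analyticAt k)
      (h.mono fun s hs => by rw [hs])
  filter_upwards [this] with s hs
  exact Monic.eq_of_coeff_eq (hF.monic s) (hG.monic s) (hF.natDegree s) (hG.natDegree s)
    fun k hk => hs k (Finset.mem_range.2 hk)

/-! ### The cone condition and its stability. -/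

/-- Near each point the differences of the roots of `F s`, for small real `s`, lie in a double
cone. -/
def HasConeRoots (F : ℂ → ℂ[X]) : Prop :=
  ∀ μ : ℂ, ∃ c : ℂ, c ≠ 0 ∧ ∀ᶠ w : ℂ × ℂ × ℂ in realPunctured ×ˢ 𝓝 μ ×ˢ 𝓝 μ,
    (F w.1).IsRoot w.2.1 → (F w.1).IsRoot w.2.2 →
      ‖c * (w.2.1 - w.2.2) ^ 2‖ ≤ 2 * (c * (w.2.1 - w.2.2) ^ 2).re

lemma HasConeRoots.mono {F G : ℂ → ℂ[X]} (hF : HasConeRoots F)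
    (h : ∀ᶠ s in 𝓝 0, ∀ x, (G s).IsRoot x → (F s).IsRoot x) : HasConeRoots G := by
  intro μ
  obtain ⟨c, hc, hF⟩ := hF μ
  refine ⟨c, hc, ?_⟩
  filter_upwards [hF, (h.filter_mono realPunctured_le_nhds).prod_inl _] with w h1 h2 hx hy
  exact h1 (h2 _ hx) (h2 _ hy)

lemma HasConeRoots.taylor {F : ℂ → ℂ[X]} (hF : HasConeRoots F) {h : ℂ → ℂ}
    (hh : ContinuousAt h 0) : HasConeRoots (fun s => taylor (h s) (F s)) := by
  intro μ
  obtain ⟨c, hc, hF⟩ := hF (μ + h 0)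
  refine ⟨c, hc, ?_⟩
  have hr : Tendsto (fun w : ℂ × ℂ × ℂ => h w.1) (realPunctured ×ˢ 𝓝 μ ×ˢ 𝓝 μ) (𝓝 (h 0)) :=
    (hh.tendsto.mono_left realPunctured_le_nhds).comp tendsto_fst
  have ht : Tendsto (fun w : ℂ × ℂ × ℂ => (w.1, w.2.1 + h w.1, w.2.2 + h w.1))
      (realPunctured ×ˢ 𝓝 μ ×ˢ 𝓝 μ) (realPunctured ×ˢ 𝓝 (μ + h 0) ×ˢ 𝓝 (μ + h 0)) :=
    tendsto_fst.prodMk (((tendsto_fst.comp tendsto_snd).add hr).prodMk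
      ((tendsto_snd.comp tendsto_snd).add hr))
  filter_upwards [ht.eventually hF] with w h1 hx hy
  simp only [IsRoot.def, taylor_eval] at hx hy h1
  simpa using h1 hx hy

/-- The roots of `F s` are `s` times those of `G s`. For real `s` the squared differences change by
the positive factor `s ^ 2`, which preserves the cone. The cone of `F` at `0` serves every `μ`,
since `s * x` tends to `0`. -/
lemma HasConeRoots.of_scaleRoots {F G : ℂ → ℂ[X]} (hF : HasConeRoots F)
    (h : ∀ᶠ s in 𝓝 0, F s = (G s).scaleRoots s) : HasConeRoots G := by
  intro μ
  obtain ⟨c, hc, hF⟩ := hF 0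
  refine ⟨c, hc, ?_⟩
  have hr : Tendsto (fun w : ℂ × ℂ × ℂ => w.1) (realPunctured ×ˢ 𝓝 μ ×ˢ 𝓝 μ) (𝓝 0) :=
    realPunctured_le_nhds.trans' tendsto_fst
  have ht : Tendsto (fun w : ℂ × ℂ × ℂ => (w.1, w.1 * w.2.1, w.1 * w.2.2))
      (realPunctured ×ˢ 𝓝 μ ×ˢ 𝓝 μ) (realPunctured ×ˢ 𝓝 0 ×ˢ 𝓝 0) := by
    refine tendsto_fst.prodMk (Tendsto.prodMk ?_ ?_)
    · simpa using hr.mul (tendsto_fst.comp tendsto_snd)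
    · simpa using hr.mul (tendsto_snd.comp tendsto_snd)
  filter_upwards [ht.eventually hF, (h.filter_mono realPunctured_le_nhds).prod_inl _,
    eventually_realPunctured_exists.prod_inl _] with w h1 h2 h3 hx hy
  obtain ⟨t, ht, hwt⟩ := h3
  have key : ∀ x, (G w.1).IsRoot x → (F w.1).IsRoot (w.1 * x) := by
    intro x hx
    rw [h2, IsRoot.def]
    simpa [hx.eq_zero, eval₂_eq_eval_map] using
      scaleRoots_eval₂_mul (p := G w.1) (RingHom.id ℂ) x w.1
  have h4 := h1 (key _ hx) (key _ hy)
  have h5 : c * (w.1 * w.2.1 - w.1 * w.2.2) ^ 2 =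
      ((t ^ 2 : ℝ) : ℂ) * (c * (w.2.1 - w.2.2) ^ 2) := by
    rw [hwt]; push_cast; ring
  simp only [h5, Complex.re_ofReal_mul, norm_mul (Complex.ofReal _), Complex.norm_real,
    Real.norm_of_nonneg (sq_nonneg t)] at h4
  have : 0 < t ^ 2 := by positivity
  nlinarith

/-! ### Analytic splittings and their transport. -/

/-- The family splits into linear factors with analytic roots. -/
def SplitsAnalytically (F : ℂ → ℂ[X]) : Prop :=
  ∃ L : Multiset (ℂ → ℂ), (∀ g ∈ L, AnalyticAt ℂ g 0) ∧
    ∀ᶠ s in 𝓝 0, F s = (L.map fun g => X - C (g s)).prod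

lemma SplitsAnalytically.mul {F G H : ℂ → ℂ[X]} (hG : SplitsAnalytically G)
    (hH : SplitsAnalytically H) (h : ∀ᶠ s in 𝓝 0, F s = G s * H s) : SplitsAnalytically F := by
  obtain ⟨L, hL, hGL⟩ := hG
  obtain ⟨L', hL', hHL⟩ := hH
  refine ⟨L + L', fun g hg => (Multiset.mem_add.1 hg).elim (hL g) (hL' g), ?_⟩
  filter_upwards [h, hGL, hHL] with s h1 h2 h3
  rw [h1, h2, h3, Multiset.map_add, Multiset.prod_add]

lemma SplitsAnalytically.of_taylor {F : ℂ → ℂ[X]} {h : ℂ → ℂ} (hh : AnalyticAt ℂ h 0)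
    (hF : SplitsAnalytically (fun s => taylor (h s) (F s))) : SplitsAnalytically F := by
  obtain ⟨L, hL, hF⟩ := hF
  refine ⟨L.map fun g s => g s + h s, fun g hg => ?_, ?_⟩
  · obtain ⟨g', hg', rfl⟩ := Multiset.mem_map.1 hg
    exact (hL g' hg').add hh
  · filter_upwards [hF] with s hs
    have h1 : F s = taylor (-h s) (taylor (h s) (F s)) := by rw [taylor_taylor]; simp
    rw [h1, hs, ← taylorAlgHom_apply, map_multiset_prod, Multiset.map_map, Multiset.map_map]
    congr 1
    refine Multiset.map_congr rfl fun g _ => ?_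
    simp [sub_eq_add_neg, add_assoc, add_comm]

lemma SplitsAnalytically.of_scaleRoots {F G : ℂ → ℂ[X]} (hG : SplitsAnalytically G)
    (h : ∀ᶠ s in 𝓝 0, F s = (G s).scaleRoots s) : SplitsAnalytically F := by
  obtain ⟨L, hL, hG⟩ := hG
  refine ⟨L.map fun g s => s * g s, fun g hg => ?_, ?_⟩
  · obtain ⟨g', hg', rfl⟩ := Multiset.mem_map.1 hg
    exact analyticAt_id.mul (hL g' hg')
  · filter_upwards [h, hG] with s h1 h2
    rw [h1, h2, Multiset.map_map]
    clear hL hG h1 h2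
    induction L using Multiset.induction with
    | empty => simp
    | cons g L ih =>
      simp only [Multiset.map_cons, Multiset.prod_cons, mul_scaleRoots_of_noZeroDivisors, ih]
      congr 1
      ext k
      rcases k with _ | _ | k <;> simp [coeff_X, coeff_C, mul_comm]

/-! ### Symmetric functions and sizes of roots. -/

lemma Polynomial.Monic.exists_eq_prod_X_sub_C {p : ℂ[X]} (hp : p.Monic) {n : ℕ}
    (hn : p.natDegree = n) : ∃ x : Fin n → ℂ, p = ∏ i, (X - C (x i)) := by
  have h1 : p = (p.roots.map fun a => X - C a).prod := by
    have := (IsAlgClosed.splits p).eq_prod_roots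
    rwa [hp.leadingCoeff, C_1, one_mul] at this
  have h2 : p.roots.toList.length = n := by
    rw [Multiset.length_toList, ← hn]
    exact ((IsAlgClosed.splits p).natDegree_eq_card_roots).symm
  subst h2
  refine ⟨fun i => p.roots.toList.get i, ?_⟩
  conv_lhs => rw [h1, ← Multiset.coe_toList p.roots]
  rw [Multiset.map_coe, Multiset.prod_coe, ← Fin.prod_univ_fun_getElem]
  rfl

/-- Newton's identities for the top three coefficients. The factor `X ^ 2` shifts the indices, so
that no truncated subtraction occurs when `S` has fewer than two elements. -/
lemma Polynomial.X_sq_mul_prod_X_sub_C_coeff {ι : Type*} (S : Finset ι) (x : ι → ℂ) :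
    (X ^ 2 * ∏ i ∈ S, (X - C (x i))).coeff (S.card + 2) = 1 ∧
    (X ^ 2 * ∏ i ∈ S, (X - C (x i))).coeff (S.card + 1) = -∑ i ∈ S, x i ∧
    2 * (X ^ 2 * ∏ i ∈ S, (X - C (x i))).coeff S.card =
      (∑ i ∈ S, x i) ^ 2 - ∑ i ∈ S, x i ^ 2 := by
  classical
  induction S using Finset.induction_on with
  | empty => simp [coeff_X_pow]
  | insert a S ha ih =>
    obtain ⟨h0, h1, h2⟩ := ih
    set P := X ^ 2 * ∏ i ∈ S, (X - C (x i)) with hP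
    have hP' : X ^ 2 * ∏ i ∈ insert a S, (X - C (x i)) = X * P - C (x a) * P := by
      rw [Finset.prod_insert ha, hP]; ring
    have htop : P.coeff (S.card + 3) = 0 := by
      apply coeff_eq_zero_of_natDegree_lt
      rw [hP, (monic_X_pow 2).natDegree_mul (monic_prod_of_monic _ _ fun i _ => monic_X_sub_C _),
        natDegree_prod_of_monic _ _ fun i _ => monic_X_sub_C _]
      simp
      omega
    rw [hP', Finset.card_insert_of_notMem ha, Finset.sum_insert ha, Finset.sum_insert ha]
    simp only [coeff_sub, coeff_X_mul, coeff_C_mul, show S.card + 1 + 2 = S.card + 2 + 1 by ring,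
      htop, h0, h1]
    refine ⟨by ring, by ring, ?_⟩
    linear_combination h2

lemma Polynomial.Monic.exists_coprime_factorization {p : ℂ[X]} (hp : p.Monic) {n : ℕ}
    (hn : p.natDegree = n) (hn0 : n ≠ 0) :
    (∃ μ, p = (X - C μ) ^ n) ∨ ∃ p₁ p₂ : ℂ[X], p₁.Monic ∧ p₂.Monic ∧ IsCoprime p₁ p₂ ∧
      p = p₁ * p₂ ∧ p₁.natDegree < n ∧ p₂.natDegree < n := by
  obtain ⟨μ, hμ⟩ := IsAlgClosed.exists_root p (by
    rw [degree_eq_natDegree hp.ne_zero, hn]; exact_mod_cast hn0)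
  obtain ⟨q, hq, hqr⟩ := exists_eq_pow_rootMultiplicity_mul_and_not_dvd p hp.ne_zero μ
  set k := p.rootMultiplicity μ
  have hk : 0 < k := (rootMultiplicity_pos hp.ne_zero).2 hμ
  have hm : ((X - C μ) ^ k).Monic := (monic_X_sub_C μ).pow k
  have hqm : q.Monic := hm.of_mul_monic_left (hq ▸ hp)
  have hd : n = k + q.natDegree := by
    rw [← hn, hq, hm.natDegree_mul hqm]; simp
  by_cases h : q.natDegree = 0
  · left
    refine ⟨μ, ?_⟩
    rw [hqm.natDegree_eq_zero.1 h, mul_one] at hq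
    rw [hq, hd, h, add_zero]
  · right
    refine ⟨_, q, hm, hqm, ?_, hq, ?_, by omega⟩
    · refine IsCoprime.pow_left ?_
      exact ((irreducible_X_sub_C μ).coprime_iff_not_dvd).2 hqr
    · simp; omega

/-- For sum zero, `∑ i, ∑ j, (x i - x j) ^ 2 = 2 * n * ∑ i, x i ^ 2`. Terms in a convex cone cannot
cancel, so the total stays in the cone and bounds each `‖x i - x j‖ ^ 2`; then `n * x i = ∑ j, (x i
- x j)` bounds `x i`. -/
lemma norm_sq_le_of_cone {n : ℕ} {x : Fin n → ℂ} {c : ℂ} (hc : c ≠ 0) (hx : ∑ i, x i = 0)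
    (h : ∀ i j, ‖c * (x i - x j) ^ 2‖ ≤ 2 * (c * (x i - x j) ^ 2).re) :
    ‖c * ∑ i, x i ^ 2‖ ≤ 2 * (c * ∑ i, x i ^ 2).re ∧
      ∀ i, ‖x i‖ ^ 2 ≤ 4 * n * ‖∑ i, x i ^ 2‖ := by
  have hsum : ∑ i, ∑ j, c * (x i - x j) ^ 2 = (2 * n : ℝ) * (c * ∑ i, x i ^ 2) := by
    simp only [← Finset.mul_sum, sub_sq, Finset.sum_add_distrib, Finset.sum_sub_distrib, hx,
      Finset.sum_const, Finset.card_univ, Fintype.card_fin, nsmul_eq_mul]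
    simp only [mul_assoc, ← Finset.mul_sum]
    simp
    ring
  have hn : 0 ≤ (2 * n : ℝ) := by positivity
  have hre : ∑ i, ∑ j, ‖c * (x i - x j) ^ 2‖ ≤ 2 * ((2 * n) * (c * ∑ i, x i ^ 2).re) := by
    rw [← Complex.re_ofReal_mul, ← hsum, Complex.re_sum, Finset.mul_sum]
    refine Finset.sum_le_sum fun i _ => ?_
    rw [Complex.re_sum, Finset.mul_sum]
    exact Finset.sum_le_sum fun j _ => h i j
  refine ⟨?_, fun i => ?_⟩
  · rcases Nat.eq_zero_or_pos n with rfl | hn0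
    · simp
    · have h1 : ‖∑ i, ∑ j, c * (x i - x j) ^ 2‖ ≤ ∑ i, ∑ j, ‖c * (x i - x j) ^ 2‖ :=
        (norm_sum_le _ _).trans (Finset.sum_le_sum fun i _ => norm_sum_le _ _)
      rw [hsum, norm_mul, Complex.norm_real, Real.norm_of_nonneg hn] at h1
      have h2 : (0 : ℝ) < 2 * n := by positivity
      refine le_of_mul_le_mul_left ((h1.trans hre).trans_eq ?_) h2
      ring
  · have hn0 : (0 : ℝ) < n := by exact_mod_cast i.pos
    have hD : ∀ j, ‖x i - x j‖ ^ 2 ≤ 4 * n * ‖∑ i, x i ^ 2‖ := by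
      intro j
      have h1 : ‖c * (x i - x j) ^ 2‖ ≤ ∑ i, ∑ j, ‖c * (x i - x j) ^ 2‖ :=
        (Finset.single_le_sum (f := fun j => ‖c * (x i - x j) ^ 2‖)
          (fun _ _ => norm_nonneg _) (Finset.mem_univ j)).trans
        (Finset.single_le_sum (f := fun i => ∑ j, ‖c * (x i - x j) ^ 2‖)
          (fun _ _ => Finset.sum_nonneg fun _ _ => norm_nonneg _) (Finset.mem_univ i))
      have h2 := h1.trans hre
      have h3 : (c * ∑ i, x i ^ 2).re ≤ ‖c‖ * ‖∑ i, x i ^ 2‖ := by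
        rw [← norm_mul]; exact Complex.re_le_norm _
      rw [norm_mul, norm_pow] at h2
      refine le_of_mul_le_mul_left ?_ (norm_pos_iff.2 hc)
      calc _ ≤ _ := h2
        _ ≤ 2 * ((2 * n) * (‖c‖ * ‖∑ i, x i ^ 2‖)) := by gcongr
        _ = _ := by ring
    have h4 : (n : ℂ) * x i = ∑ j, (x i - x j) := by
      simp [Finset.sum_sub_distrib, hx]
    have h5 : n * ‖x i‖ ≤ n * Real.sqrt (4 * n * ‖∑ i, x i ^ 2‖) := by
      calc n * ‖x i‖ = ‖(n : ℂ) * x i‖ := by simp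
        _ ≤ ∑ j, ‖x i - x j‖ := by rw [h4]; exact norm_sum_le _ _
        _ ≤ ∑ j : Fin n, Real.sqrt (4 * n * ‖∑ i, x i ^ 2‖) :=
          Finset.sum_le_sum fun j _ => Real.le_sqrt_of_sq_le (hD j)
        _ = _ := by simp
    have h6 := le_of_mul_le_mul_left h5 hn0
    calc ‖x i‖ ^ 2 ≤ Real.sqrt (4 * n * ‖∑ i, x i ^ 2‖) ^ 2 := by gcongr
      _ = _ := Real.sq_sqrt (by positivity)

lemma Polynomial.Monic.norm_lt_of_isRoot {p : ℂ[X]} (hp : p.Monic) {n : ℕ} (hn : p.natDegree = n)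
    {r : ℝ} (hr : 0 < r) (h : ∀ k < n, n * ‖p.coeff k‖ < r ^ (n - k)) {x : ℂ} (hx : p.IsRoot x) :
    ‖x‖ < r := by
  by_contra! hxr
  have hx0 : 0 < ‖x‖ := hr.trans_le hxr
  have h1 : x ^ n = -∑ k ∈ Finset.range n, p.coeff k * x ^ k := by
    have := hx.eq_zero
    rw [eval_eq_sum_range, hn, Finset.sum_range_succ, ← hn, hp.coeff_natDegree, one_mul, hn] at this
    exact eq_neg_of_add_eq_zero_right this
  rcases Nat.eq_zero_or_pos n with rfl | hn0
  · simp at h1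
  have hn0' : (0 : ℝ) < n := by exact_mod_cast hn0
  have h2 : ‖x‖ ^ n ≤ ∑ k ∈ Finset.range n, ‖p.coeff k‖ * ‖x‖ ^ k := by
    rw [← norm_pow, h1, norm_neg]
    refine (norm_sum_le _ _).trans_eq ?_
    simp
  have h3 : ∑ k ∈ Finset.range n, n * (‖p.coeff k‖ * ‖x‖ ^ k) <
      ∑ k ∈ Finset.range n, ‖x‖ ^ n := by
    refine Finset.sum_lt_sum_of_nonempty ⟨0, by simpa using hn0⟩ fun k hk => ?_
    have hk := Finset.mem_range.1 hk
    calc n * (‖p.coeff k‖ * ‖x‖ ^ k) = (n * ‖p.coeff k‖) * ‖x‖ ^ k := by ring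
      _ < r ^ (n - k) * ‖x‖ ^ k := mul_lt_mul_of_pos_right (h k hk) (pow_pos hx0 k)
      _ ≤ ‖x‖ ^ (n - k) * ‖x‖ ^ k := by gcongr
      _ = ‖x‖ ^ n := by rw [← pow_add, Nat.sub_add_cancel hk.le]
  rw [← Finset.mul_sum] at h3
  simp only [Finset.sum_const, Finset.card_range, nsmul_eq_mul] at h3
  exact absurd (lt_of_mul_lt_mul_left h3 hn0'.le) (not_lt.2 h2)

/-- This brings all roots into the neighbourhood of `0` where the cone condition at `0` applies. -/
lemma IsAnalyticFamily.tendsto_roots {n : ℕ} {F : ℂ → ℂ[X]} (hF : IsAnalyticFamily n F)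
    (h0 : F 0 = X ^ n) {r : ℝ} (hr : 0 < r) :
    ∀ᶠ s in 𝓝 0, ∀ x, (F s).IsRoot x → ‖x‖ < r := by
  have : ∀ᶠ s in 𝓝 0, ∀ k ∈ Finset.range n, n * ‖(F s).coeff k‖ < r ^ (n - k) := by
    rw [eventually_all_finset]
    intro k hk
    have hk := Finset.mem_range.1 hk
    have ht : Tendsto (fun s => n * ‖(F s).coeff k‖) (𝓝 0) (𝓝 (n * ‖(F 0).coeff k‖)) :=
      (hF.analyticAt k).continuousAt.tendsto.norm.const_mul _
    refine ht.eventually_lt_const ?_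
    rw [h0, coeff_X_pow, if_neg hk.ne]
    simpa using pow_pos hr _
  filter_upwards [this] with s hs x hx
  exact (hF.monic s).norm_lt_of_isRoot (hF.natDegree s) hr
    (fun k hk => hs k (Finset.mem_range.2 hk)) hx

/-! ### Centred families and division of the roots by `s`. -/

/-- Estimates for the roots of a centred family with a single root at `s = 0`. -/
lemma IsAnalyticFamily.root_estimates {m : ℕ} {F : ℂ → ℂ[X]} (hF : IsAnalyticFamily (m + 2) F)
    (hcone : HasConeRoots F) (hcent : ∀ᶠ s in 𝓝 0, (F s).coeff (m + 1) = 0)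
    (h0 : F 0 = X ^ (m + 2)) : ∃ c : ℂ, c ≠ 0 ∧ ∀ᶠ s in realPunctured,
      ‖c * (F s).coeff m‖ ≤ -2 * (c * (F s).coeff m).re ∧
      ∀ x, (F s).IsRoot x → ‖x‖ ^ 2 ≤ 8 * (m + 2) * ‖(F s).coeff m‖ := by
  obtain ⟨c, hc, hcone⟩ := hcone 0
  refine ⟨c, hc, ?_⟩
  rw [eventually_prod_iff] at hcone
  obtain ⟨p₁, hp₁, p₂, hp₂, hcone⟩ := hcone
  rw [← nhds_prod_eq, Metric.eventually_nhds_iff] at hp₂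
  obtain ⟨r, hr, hp₂⟩ := hp₂
  filter_upwards [hp₁, hcent.filter_mono realPunctured_le_nhds,
    (hF.tendsto_roots h0 hr).filter_mono realPunctured_le_nhds] with s h1 h2 h3
  obtain ⟨x, hx⟩ := (hF.monic s).exists_eq_prod_X_sub_C (hF.natDegree s)
  have hroot : ∀ i, (F s).IsRoot (x i) := by
    intro i
    rw [hx, IsRoot.def, eval_prod]
    exact Finset.prod_eq_zero (Finset.mem_univ i) (by simp)
  obtain ⟨-, he1, he2⟩ := X_sq_mul_prod_X_sub_C_coeff Finset.univ x
  rw [← hx] at he1 he2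
  simp only [Finset.card_univ, Fintype.card_fin] at he1 he2
  rw [show m + 2 + 1 = (m + 1) + 2 by ring, coeff_X_pow_mul, h2] at he1
  have hsum : ∑ i, x i = 0 := by linear_combination he1
  rw [coeff_X_pow_mul, hsum] at he2
  -- This sign turns the cone for the sum of squares into the opposite cone for the coefficient.
  have he : ∑ i, x i ^ 2 = -2 * (F s).coeff m := by linear_combination he2
  have hbound : ∀ i j, ‖c * (x i - x j) ^ 2‖ ≤ 2 * (c * (x i - x j) ^ 2).re := by
    intro i j
    refine hcone h1 (y := (x i, x j)) (hp₂ ?_) (hroot i) (hroot j)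
    simpa [Prod.dist_eq] using ⟨h3 _ (hroot i), h3 _ (hroot j)⟩
  obtain ⟨hA, hB⟩ := norm_sq_le_of_cone hc hsum hbound
  rw [he] at hA hB
  constructor
  · have h4 : c * (-2 * (F s).coeff m) = ((-2 : ℝ) : ℂ) * (c * (F s).coeff m) := by
      push_cast; ring
    rw [h4, norm_mul, Complex.re_ofReal_mul, Complex.norm_real] at hA
    rw [show ‖(-2 : ℝ)‖ = 2 by norm_num] at hA
    linarith
  · intro y hy
    rw [hx, IsRoot.def, eval_prod, Finset.prod_eq_zero_iff] at hy
    obtain ⟨i, -, hi⟩ := hy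
    have hi' : y = x i := by simpa [sub_eq_zero] using hi
    rw [hi']
    refine (hB i).trans_eq ?_
    rw [norm_mul]
    norm_num
    ring

lemma IsAnalyticFamily.taylor {n : ℕ} {F : ℂ → ℂ[X]} (hF : IsAnalyticFamily n F) {h : ℂ → ℂ}
    (hh : AnalyticAt ℂ h 0) : IsAnalyticFamily n (fun s => taylor (h s) (F s)) := by
  refine ⟨fun s => (leadingCoeff_taylor _ _).trans (hF.monic s), fun s => by rw [natDegree_taylor, hF.natDegree s],
    fun k => ?_⟩
  have h1 : (fun s => (Polynomial.taylor (h s) (F s)).coeff k) = fun s =>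
      ∑ i ∈ Finset.range (n + 1), ((i + k).choose k * (F s).coeff (i + k)) * h s ^ i := by
    funext s
    rw [taylor_coeff, eval_eq_sum_range' (n := n + 1)]
    · simp [hasseDeriv_coeff]
    · have := natDegree_hasseDeriv_le (F s) k
      rw [hF.natDegree s] at this
      omega
  rw [h1]
  refine Finset.analyticAt_fun_sum _ fun i _ => ?_
  exact (analyticAt_const.mul (hF.analyticAt _)).mul (hh.pow i)

lemma Polynomial.Monic.coeff_taylor_natDegree_pred {p : ℂ[X]} (hp : p.Monic) {m : ℕ}
    (hn : p.natDegree = m + 1) (r : ℂ) :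
    (taylor r p).coeff m = p.coeff m + (m + 1) * r := by
  have h1 := natDegree_hasseDeriv_le p m
  have h2 := hp.coeff_natDegree
  rw [hn] at h2
  rw [taylor_coeff, eval_eq_sum_range' (n := 2) (by omega)]
  simp [Finset.sum_range_succ, hasseDeriv_coeff, add_comm 1 m, h2]

/-- The second coefficient of a centred family vanishes to second order. -/
lemma IsAnalyticFamily.exists_coeff_eq_sq_mul {m : ℕ} {F : ℂ → ℂ[X]}
    (hF : IsAnalyticFamily (m + 2) F) (h0 : F 0 = X ^ (m + 2)) {c : ℂ} (hc : c ≠ 0)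
    (h : ∀ᶠ s in realPunctured, ‖c * (F s).coeff m‖ ≤ -2 * (c * (F s).coeff m).re) :
    ∃ g : ℂ → ℂ, AnalyticAt ℂ g 0 ∧ ∀ᶠ s in 𝓝 0, (F s).coeff m = s ^ 2 * g s := by
  have hd := hF.analyticAt m
  have hd0 : (F 0).coeff m = 0 := by rw [h0, coeff_X_pow, if_neg (by omega)]
  have hord : ((1 : ℕ) : ℕ∞) ≤ analyticOrderAt (fun s => (F s).coeff m) 0 := by
    rw [Nat.cast_one, Order.one_le_iff_ne_zero]
    exact analyticOrderAt_ne_zero.2 ⟨hd, hd0⟩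
  obtain ⟨g, hg, hdg⟩ := (natCast_le_analyticOrderAt hd).1 hord
  simp only [sub_zero, pow_one, smul_eq_mul] at hdg
  -- The coefficient is `s * g s`. Adding the cone inequalities at `s` and `-s` leaves only `g s - g
  -- (-s)` on the right; this tends to `0`, hence `g 0 = 0`.
  have hb : ∀ᶠ s in realPunctured, ‖g s‖ ≤ 2 * ‖g s - g (-s)‖ := by
    have h1 := hdg.filter_mono realPunctured_le_nhds
    filter_upwards [h, tendsto_neg_realPunctured.eventually h, h1,
      tendsto_neg_realPunctured.eventually h1, realPunctured_le self_mem_nhdsWithin]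
      with s h2 h3 h4 h5 hs
    rw [h4] at h2
    rw [h5] at h3
    have h6 : (c * (s * g s)).re + (c * (-s * g (-s))).re =
        (c * s * (g s - g (-s))).re := by
      rw [← Complex.add_re]; congr 1; ring
    have h7 := Complex.abs_re_le_norm (c * s * (g s - g (-s)))
    have h8 := neg_abs_le (c * s * (g s - g (-s))).re
    have h9 := norm_nonneg (c * (-s * g (-s)))
    have h10 : ‖c * (s * g s)‖ = ‖c * s‖ * ‖g s‖ := by rw [← mul_assoc, norm_mul]
    rw [norm_mul] at h7
    have hpos : 0 < ‖c * s‖ := norm_pos_iff.2 (mul_ne_zero hc hs)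
    refine le_of_mul_le_mul_left ?_ hpos
    linarith
  have hg0 : g 0 = 0 := by
    have hn : Tendsto (fun s : ℂ => g (-s)) realPunctured (𝓝 (g 0)) :=
      (hg.continuousAt.tendsto.mono_left realPunctured_le_nhds).comp tendsto_neg_realPunctured
    have hp := hg.continuousAt.tendsto.mono_left realPunctured_le_nhds
    have h2 := le_of_tendsto_of_tendsto hp.norm ((hp.sub hn).norm.const_mul 2) hb
    simpa using h2
  have hord' : ((1 : ℕ) : ℕ∞) ≤ analyticOrderAt g 0 := by
    rw [Nat.cast_one, Order.one_le_iff_ne_zero]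
    exact analyticOrderAt_ne_zero.2 ⟨hg, hg0⟩
  obtain ⟨g', hg', hgg'⟩ := (natCast_le_analyticOrderAt hg).1 hord'
  refine ⟨g', hg', ?_⟩
  filter_upwards [hdg, hgg'] with s h1 h2
  rw [h1, h2]
  simp
  ring

/-- A centred family with a single root at `s = 0` arises from another centred family by scaling
the roots with `s`. -/
lemma IsAnalyticFamily.exists_eq_scaleRoots {m : ℕ} {F : ℂ → ℂ[X]}
    (hF : IsAnalyticFamily (m + 2) F) (hcone : HasConeRoots F)
    (hcent : ∀ᶠ s in 𝓝 0, (F s).coeff (m + 1) = 0) (h0 : F 0 = X ^ (m + 2)) :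
    ∃ G : ℂ → ℂ[X], IsAnalyticFamily (m + 2) G ∧ HasConeRoots G ∧
      (∀ᶠ s in 𝓝 0, (G s).coeff (m + 1) = 0) ∧ ∀ᶠ s in 𝓝 0, F s = (G s).scaleRoots s := by
  obtain ⟨c, hc, hest⟩ := hF.root_estimates hcone hcent h0
  obtain ⟨d, hd, hFd⟩ := hF.exists_coeff_eq_sq_mul h0 hc (hest.mono fun s hs => hs.1)
  obtain ⟨K, hK0, hK⟩ : ∃ K : ℝ, 0 ≤ K ∧ ∀ᶠ s in realPunctured,
      ∀ x, (F s).IsRoot x → ‖x‖ ≤ K * ‖s‖ := by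
    refine ⟨Real.sqrt (8 * (m + 2) * (‖d 0‖ + 1)), Real.sqrt_nonneg _, ?_⟩
    have hdb : ∀ᶠ s in 𝓝 0, ‖d s‖ < ‖d 0‖ + 1 :=
      hd.continuousAt.tendsto.norm.eventually_lt_const (lt_add_one _)
    filter_upwards [hest, hdb.filter_mono realPunctured_le_nhds,
      hFd.filter_mono realPunctured_le_nhds] with s h1 h2 h3 x hx
    have h4 := h1.2 x hx
    rw [h3, norm_mul, norm_pow] at h4
    refine le_of_sq_le_sq ?_ (by positivity)
    rw [mul_pow, Real.sq_sqrt (by positivity)]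
    calc ‖x‖ ^ 2 ≤ _ := h4
      _ ≤ 8 * (m + 2) * (‖s‖ ^ 2 * (‖d 0‖ + 1)) := by gcongr
      _ = _ := by ring
  -- Up to sign, coefficient `k` is a sum of products of `m + 2 - k` roots, each `O(s)`; this is the
  -- power of `s` that `scaleRoots` puts there.
  have hcoef : ∀ k, ∃ g : ℂ → ℂ, AnalyticAt ℂ g 0 ∧
      ∀ᶠ s in 𝓝 0, (F s).coeff k = s ^ (m + 2 - k) * g s := by
    intro k
    refine (hF.analyticAt k).exists_eq_pow_mul_of_bound _ (K ^ (m + 2 - k) * (m + 2).choose k) ?_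
    filter_upwards [hK] with s hs
    have := coeff_le_of_roots_le (f := RingHom.id ℂ) (B := K * ‖s‖) k (hF.monic s)
      (by simpa using IsAlgClosed.splits (F s)) (by
        intro z hz
        rw [Polynomial.map_id, mem_roots (hF.monic s).ne_zero] at hz
        exact hs z hz)
    rw [Polynomial.map_id, hF.natDegree s, mul_pow] at this
    refine this.trans_eq ?_
    ring
  choose g hg hFg using hcoef
  have hG : IsAnalyticFamily (m + 2)
      (fun s => monicOfCoeffs (fun k : Fin (m + 2) => g k s)) :=
    isAnalyticFamily_monicOfCoeffs (u := fun s (k : Fin (m + 2)) => g k s)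
      (analyticAt_pi_iff.2 fun k => hg k)
  have hGc : ∀ k < m + 2, ∀ s,
      (monicOfCoeffs (fun k : Fin (m + 2) => g k s)).coeff k = g k s := by
    intro k hk s
    simp [monicOfCoeffs, coeff_ofCoeffs, hk, hk.ne]
  have hscale : ∀ᶠ s in 𝓝 0,
      F s = (monicOfCoeffs (fun k : Fin (m + 2) => g k s)).scaleRoots s := by
    have : ∀ᶠ s in 𝓝 0, ∀ k ∈ Finset.range (m + 2), (F s).coeff k = s ^ (m + 2 - k) * g k s := by
      rw [eventually_all_finset]
      exact fun k _ => hFg k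
    filter_upwards [this] with s hs
    refine Monic.eq_of_coeff_eq (hF.monic s) ((monic_scaleRoots_iff s).2 (hG.monic s))
      (hF.natDegree s) (by rw [natDegree_scaleRoots, hG.natDegree s]) fun k hk => ?_
    rw [hs k (Finset.mem_range.2 hk), coeff_scaleRoots, hG.natDegree s, hGc k hk, mul_comm]
  refine ⟨_, hG, hcone.of_scaleRoots hscale, ?_, hscale⟩
  simp only [hGc (m + 1) (by omega)]
  refine (hg (m + 1)).eventually_eq_zero_of_pow_mul 1 ?_
  filter_upwards [hcent, hFg (m + 1)] with s h1 h2
  rw [h1, show m + 2 - (m + 1) = 1 by omega] at h2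
  exact h2.symm

/-- The case of infinite order, where dividing by `s` would never end: the root estimate makes all
roots zero for small real `s`, and the identity theorem does the rest. -/
lemma IsAnalyticFamily.splitsAnalytically_of_coeff_eq_zero {m : ℕ} {F : ℂ → ℂ[X]}
    (hF : IsAnalyticFamily (m + 2) F) (hcone : HasConeRoots F)
    (hcent : ∀ᶠ s in 𝓝 0, (F s).coeff (m + 1) = 0) (h0 : F 0 = X ^ (m + 2))
    (hd : ∀ᶠ s in 𝓝 0, (F s).coeff m = 0) : SplitsAnalytically F := by
  obtain ⟨c, hc, hest⟩ := hF.root_estimates hcone hcent h0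
  refine ⟨Multiset.replicate (m + 2) (fun _ => 0), fun g hg => ?_, ?_⟩
  · rw [Multiset.eq_of_mem_replicate hg]
    exact analyticAt_const
  · simp only [Multiset.map_replicate, Multiset.prod_replicate, C_0, sub_zero]
    have hX : IsAnalyticFamily (m + 2) (fun _ => (X : ℂ[X]) ^ (m + 2)) :=
      ⟨fun _ => monic_X_pow _, fun _ => natDegree_X_pow _, fun _ => analyticAt_const⟩
    refine hF.eventually_eq_of_realPunctured hX ?_
    filter_upwards [hest, hd.filter_mono realPunctured_le_nhds] with s h1 h2
    obtain ⟨x, hx⟩ := (hF.monic s).exists_eq_prod_X_sub_C (hF.natDegree s)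
    have hx0 : ∀ i, x i = 0 := by
      intro i
      have hroot : (F s).IsRoot (x i) := by
        rw [hx, IsRoot.def, eval_prod]
        exact Finset.prod_eq_zero (Finset.mem_univ i) (by simp)
      have := h1.2 _ hroot
      rw [h2] at this
      simpa using this
    rw [hx]
    simp [hx0]

/-! ### Analyticity of the roots. -/

/-- Rellich's theorem: if the roots for real `s` lie, up to second order, on a line, then the roots
are analytic. -/
theorem IsAnalyticFamily.splitsAnalytically {n : ℕ} {F : ℂ → ℂ[X]} (hF : IsAnalyticFamily n F)
    (hcone : HasConeRoots F) : SplitsAnalytically F := by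
  induction n using Nat.strong_induction_on generalizing F with
  | _ n ih =>
  -- Distinct roots at `s = 0` give two factors of lower degree, which inherit the cone condition.
  have hsplit : ∀ F : ℂ → ℂ[X], IsAnalyticFamily n F → HasConeRoots F → n ≠ 0 →
      (∃ μ, F 0 = (X - C μ) ^ n) ∨ SplitsAnalytically F := by
    intro F hF hcone hn
    refine ((hF.monic 0).exists_coprime_factorization (hF.natDegree 0) hn).imp_right ?_
    rintro ⟨p, q, hp, hq, hpq, h0, hpn, hqn⟩
    obtain ⟨G, H, hG, hH, hFGH⟩ := hF.exists_factorization hp hq hpq h0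
    refine (ih _ hpn hG (hcone.mono ?_)).mul (ih _ hqn hH (hcone.mono ?_)) hFGH
    · filter_upwards [hFGH] with s hs x hx
      rw [hs]; exact root_mul_right_of_isRoot _ hx
    · filter_upwards [hFGH] with s hs x hx
      rw [hs]; exact root_mul_left_of_isRoot _ hx
  match n, hF, ih, hsplit with
  | 0, hF, _, _ =>
    exact ⟨0, by simp, Eventually.of_forall fun s => by
      simpa using (hF.monic s).natDegree_eq_zero.1 (hF.natDegree s)⟩
  | 1, hF, _, _ =>
    refine ⟨{fun s => -(F s).coeff 0}, ?_, Eventually.of_forall fun s => ?_⟩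
    · intro g hg
      rw [Multiset.mem_singleton.1 hg]
      exact (hF.analyticAt 0).neg
    · have := (hF.monic s).as_sum
      rw [hF.natDegree s] at this
      simpa using this
  | m + 2, hF, _, hsplit =>
    have hX : ∀ F : ℂ → ℂ[X], (∀ᶠ s in 𝓝 0, (F s).coeff (m + 1) = 0) →
        (∃ μ, F 0 = (X - C μ) ^ (m + 2)) → F 0 = X ^ (m + 2) := by
      rintro F hcent ⟨μ, hμ⟩
      have h1 := hcent.self_of_nhds
      rw [hμ, sub_eq_add_neg, ← C_neg, coeff_X_add_C_pow, show m + 2 - (m + 1) = 1 by omega] at h1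
      have h2 : μ = 0 := by
        have : (m : ℂ) + 1 + 1 ≠ 0 := by exact_mod_cast (by omega : m + 1 + 1 ≠ 0)
        simpa [this] using h1
      rw [hμ, h2, C_0, sub_zero]
    -- Inner induction on the order of coefficient `m`: dividing the roots by `s` divides this
    -- coefficient by `s ^ 2`.
    have hcentred : ∀ k : ℕ, ∀ F : ℂ → ℂ[X], IsAnalyticFamily (m + 2) F → HasConeRoots F →
        (∀ᶠ s in 𝓝 0, (F s).coeff (m + 1) = 0) →
        analyticOrderAt (fun s => (F s).coeff m) 0 = k → SplitsAnalytically F := by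
      intro k
      induction k using Nat.strong_induction_on with
      | _ k ihk =>
      intro F hF hcone hcent hk
      rcases hsplit F hF hcone (by omega) with h | h
      swap
      · exact h
      obtain ⟨G, hG, hGcone, hGcent, hFG⟩ := hF.exists_eq_scaleRoots hcone hcent (hX F hcent h)
      refine SplitsAnalytically.of_scaleRoots ?_ hFG
      have h1 : (fun s => (F s).coeff m) =ᶠ[𝓝 0] (fun s => s) ^ 2 * fun s => (G s).coeff m := by
        filter_upwards [hFG] with s hs
        rw [hs, coeff_scaleRoots, hG.natDegree s, show m + 2 - m = 2 by omega]
        simp [mul_comm]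
      have hid : analyticOrderAt (fun s : ℂ => s) 0 = 1 := by
        simpa using analyticOrderAt_centeredMonomial (𝕜 := ℂ) (z₀ := 0) (n := 1)
      have hanid : AnalyticAt ℂ (fun s : ℂ => s) 0 := analyticAt_id
      rw [analyticOrderAt_congr h1, analyticOrderAt_mul (hanid.pow 2) (hG.analyticAt m),
        analyticOrderAt_pow hanid, hid] at hk
      have hfin : analyticOrderAt (fun s => (G s).coeff m) 0 ≠ ⊤ := by
        intro h
        simp [h] at hk
      obtain ⟨j, hj⟩ := ENat.ne_top_iff_exists.1 hfin
      rw [← hj] at hk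
      have hk' : 2 + j = k := by
        have : ((2 + j : ℕ) : ℕ∞) = k := by rw [← hk]; simp
        exact_mod_cast this
      exact ihk j (by omega) G hG hGcone hGcent hj.symm
    -- The mean of the roots; it is analytic, and subtracting it centres the family.
    set h : ℂ → ℂ := fun s => -(F s).coeff (m + 1) / (m + 2) with hh
    have hhan : AnalyticAt ℂ h 0 := (hF.analyticAt (m + 1)).neg.div_const
    refine SplitsAnalytically.of_taylor hhan ?_
    have hF' := hF.taylor hhan
    have hcone' := hcone.taylor hhan.continuousAt
    have hcent : ∀ᶠ s in 𝓝 0, (Polynomial.taylor (h s) (F s)).coeff (m + 1) = 0 := by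
      refine Eventually.of_forall fun s => ?_
      have hm : (m + 2 : ℂ) ≠ 0 := by exact_mod_cast (by omega : m + 2 ≠ 0)
      rw [(hF.monic s).coeff_taylor_natDegree_pred (hF.natDegree s), hh]
      push_cast
      field_simp
      ring
    by_cases htop : analyticOrderAt (fun s => (Polynomial.taylor (h s) (F s)).coeff m) 0 = ⊤
    · rcases hsplit _ hF' hcone' (by omega) with h1 | h1
      · exact hF'.splitsAnalytically_of_coeff_eq_zero hcone' hcent (hX _ hcent h1)
          (analyticOrderAt_eq_top.1 htop)
      · exact h1
    · obtain ⟨k, hk⟩ := ENat.ne_top_iff_exists.1 htop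
      exact hcentred k _ hF' hcone' hcent hk.symm

/-! ### Even root functions and pairs. -/

lemma AnalyticAt.exists_hasSum {g : ℂ → ℂ} (hg : AnalyticAt ℂ g 0) :
    ∃ c : ℕ → ℂ, ∀ᶠ s in 𝓝 0, HasSum (fun j => c j * s ^ j) (g s) := by
  obtain ⟨p, hp⟩ := hg
  refine ⟨p.coeff, ?_⟩
  filter_upwards [hasFPowerSeriesAt_iff.1 hp] with s hs
  simpa [mul_comm] using hs

lemma AnalyticAt.comp_neg_zero {g : ℂ → ℂ} (hg : AnalyticAt ℂ g 0) :
    AnalyticAt ℂ (fun s => g (-s)) 0 :=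
  AnalyticAt.comp (g := g) (by simpa using hg) analyticAt_id.neg

lemma tendsto_neg_nhds_zero : Tendsto (fun s : ℂ => -s) (𝓝 0) (𝓝 0) :=
  continuous_neg.tendsto' 0 0 neg_zero

/-- An even analytic function is a power series in `s ^ 2`. -/
lemma AnalyticAt.exists_hasSum_sq {g : ℂ → ℂ} (hg : AnalyticAt ℂ g 0)
    (heven : ∀ᶠ s in 𝓝 0, g (-s) = g s) :
    ∃ c : ℕ → ℂ, ∀ᶠ s in 𝓝 0, HasSum (fun j => c j * (s ^ 2) ^ j) (g s) := by
  obtain ⟨c, hc⟩ := hg.exists_hasSum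
  refine ⟨fun j => c (2 * j), ?_⟩
  filter_upwards [hc, tendsto_neg_nhds_zero.eventually hc, heven] with s h1 h2 h3
  rw [h3] at h2
  -- Averaging the series at `s` and `-s` cancels the odd terms.
  have h4 := (h1.add h2).mul_left (1 / 2)
  have hinj : Function.Injective (fun j : ℕ => 2 * j) := fun a b h => by simpa using h
  rw [← hinj.hasSum_iff] at h4
  · have h5 : (fun j => c (2 * j) * (s ^ 2) ^ j) =
        (fun i => 1 / 2 * (c i * s ^ i + c i * (-s) ^ i)) ∘ fun j => 2 * j := by
      funext j
      simp only [Function.comp, pow_mul, neg_sq]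
      ring
    have h6 : g s = 1 / 2 * (g s + g s) := by ring
    rw [h5, h6]
    exact h4
  · intro j hj
    have hodd : Odd j := by
      rw [← Nat.not_even_iff_odd]
      rintro ⟨i, rfl⟩
      exact hj ⟨i, by simp; ring⟩
    rw [hodd.neg_pow]
    ring

/-- A list of analytic functions that is symmetric under `s ↦ -s` consists of even functions and of
pairs. -/
lemma exists_even_and_pairs (L : Multiset (ℂ → ℂ)) (hL : ∀ g ∈ L, AnalyticAt ℂ g 0)
    (hsym : ∀ᶠ s in 𝓝 0, (L.map fun g => X - C (g s)).prod = (L.map fun g => X - C (g (-s))).prod) :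
    ∃ M N : Multiset (ℂ → ℂ),
      (∀ g ∈ M, AnalyticAt ℂ g 0 ∧ ∀ᶠ s in 𝓝 0, g (-s) = g s) ∧
      (∀ g ∈ N, AnalyticAt ℂ g 0 ∧ ¬ ∀ᶠ s in 𝓝 0, g (-s) = g s) ∧
      ∀ᶠ s in 𝓝 0, (L.map fun g => X - C (g s)).prod = (M.map fun g => X - C (g s)).prod *
        (N.map fun g => (X - C (g s)) * (X - C (g (-s)))).prod := by
  classical
  induction hn : L.card using Nat.strong_induction_on generalizing L with
  | _ n ih =>
  rcases L.empty_or_exists_mem with rfl | ⟨g, hg⟩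
  · exact ⟨0, 0, by simp, by simp, by simp⟩
  obtain ⟨L', rfl⟩ := Multiset.exists_cons_of_mem hg
  have hgan := hL g (Multiset.mem_cons_self _ _)
  simp only [Multiset.map_cons, Multiset.prod_cons] at hsym ⊢
  by_cases heven : ∀ᶠ s in 𝓝 0, g (-s) = g s
  · obtain ⟨M, N, hM, hN, hMN⟩ := ih L'.card (by rw [← hn, Multiset.card_cons]; omega) L'
      (fun h hh => hL h (Multiset.mem_cons_of_mem hh)) (by
        filter_upwards [hsym, heven] with s h1 h2
        rw [h2] at h1
        exact mul_left_cancel₀ (X_sub_C_ne_zero _) h1) rfl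
    refine ⟨g ::ₘ M, N, ?_, hN, ?_⟩
    · intro h hh
      rcases Multiset.mem_cons.1 hh with rfl | hh
      · exact ⟨hgan, heven⟩
      · exact hM h hh
    · filter_upwards [hMN] with s hs
      rw [hs, Multiset.map_cons, Multiset.prod_cons, mul_assoc]
  -- By symmetry `g (-s)` is a root at `s`. As the list is finite, one `h` matches it for
  -- arbitrarily small `s ≠ 0`, hence identically near `0`.
  · have hex : ∀ᶠ s in 𝓝 0, ∃ h ∈ insert g L'.toFinset, g (-s) = h s := by
      filter_upwards [hsym] with s hs
      have h1 : eval (g (-s)) ((X - C (g s)) * (L'.map fun g => X - C (g s)).prod) = 0 := by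
        rw [hs]; simp
      rw [eval_mul, mul_eq_zero] at h1
      rcases h1 with h1 | h1
      · exact ⟨g, by simp, by simpa [sub_eq_zero] using h1⟩
      · rw [eval_multiset_prod, Multiset.prod_eq_zero_iff, Multiset.map_map, Multiset.mem_map] at h1
        obtain ⟨h, hh, h0⟩ := h1
        exact ⟨h, by simp [hh], by simpa [sub_eq_zero] using h0⟩
    have hfreq : ∃ h ∈ insert g L'.toFinset,
        ∃ᶠ s in 𝓝[≠] 0, g (-s) = h s := by
      by_contra! hcon
      have h2 : ∀ᶠ s in 𝓝[≠] (0 : ℂ), ∀ h ∈ insert g L'.toFinset,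
          g (-s) ≠ h s := by
        rw [eventually_all_finset]
        intro h hh
        exact hcon h hh
      obtain ⟨s, hs, h, hh, h0⟩ := (h2.and (hex.filter_mono nhdsWithin_le_nhds)).exists
      exact hs h hh h0
    obtain ⟨h, hh, hfreq⟩ := hfreq
    have hhL : h ∈ g ::ₘ L' := by simpa using hh
    have heq := (hgan.comp_neg_zero.frequently_eq_iff_eventually_eq (hL h hhL)).1 hfreq
    have hne : h ≠ g := by
      rintro rfl
      exact heven heq
    obtain ⟨L'', rfl⟩ := Multiset.exists_cons_of_mem ((Multiset.mem_cons.1 hhL).resolve_left hne)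
    simp only [Multiset.map_cons, Multiset.prod_cons] at hsym ⊢
    obtain ⟨M, N, hM, hN, hMN⟩ := ih L''.card
      (by rw [← hn, Multiset.card_cons, Multiset.card_cons]; omega) L''
      (fun h hh => hL h (Multiset.mem_cons_of_mem (Multiset.mem_cons_of_mem hh))) (by
        filter_upwards [hsym, heq, tendsto_neg_nhds_zero.eventually heq] with s h1 h2 h3
        rw [neg_neg] at h3
        rw [← h2, ← h3] at h1
        -- As `h s = g (-s)` and `h (-s) = g s`, the two removed factors are merely exchanged by `s
        -- ↦ -s`, so the rest stays symmetric.
        refine mul_left_cancel₀ (mul_ne_zero (X_sub_C_ne_zero (g s)) (X_sub_C_ne_zero (g (-s)))) ?_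
        linear_combination h1) rfl
    refine ⟨M, g ::ₘ N, hM, ?_, ?_⟩
    · intro k hk
      rcases Multiset.mem_cons.1 hk with rfl | hk
      · exact ⟨hgan, heven⟩
      · exact hN k hk
    · filter_upwards [hMN, heq] with s h1 h2
      rw [h1, ← h2, Multiset.map_cons, Multiset.prod_cons]
      ring

/-! ### Roots on the unit circle. -/

/-- For points on the unit circle the squared difference is a multiple of `-(x * y)`. -/
lemma sub_sq_of_norm_eq_one {x y : ℂ} (hx : ‖x‖ = 1) (hy : ‖y‖ = 1) :
    (x - y) ^ 2 = -(x * y) * (‖x - y‖ ^ 2 : ℝ) := by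
  have h1 : x * (starRingEnd ℂ) x = 1 := by rw [Complex.mul_conj']; simp [hx]
  have h2 : y * (starRingEnd ℂ) y = 1 := by rw [Complex.mul_conj']; simp [hy]
  have h3 : ((‖x - y‖ ^ 2 : ℝ) : ℂ) = (x - y) * (starRingEnd ℂ) (x - y) := by
    rw [Complex.mul_conj']; push_cast; rfl
  rw [h3, map_sub]
  linear_combination (x - y) * y * h1 - (x - y) * x * h2

lemma hasConeRoots_of_norm_eq_one {F : ℂ → ℂ[X]}
    (h : ∀ᶠ s in realPunctured, ∀ x, (F s).IsRoot x → ‖x‖ = 1) : HasConeRoots F := by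
  intro μ
  by_cases hμ : ‖μ‖ = 1
  · have hμ0 : μ ≠ 0 := by
      rintro rfl
      simp at hμ
    -- Here `c * μ ^ 2 = 1`, so `-c * (x - y) ^ 2 = ‖x - y‖ ^ 2 * (c * x * y)` with the real part of
    -- `c * x * y` above `1 / 2` near `(μ, μ)`. This matches the factor `2` in `HasConeRoots`.
    set c := (starRingEnd ℂ) μ ^ 2 with hc
    have hcn : ‖c‖ = 1 := by rw [hc, norm_pow, RCLike.norm_conj, hμ, one_pow]
    refine ⟨-c, neg_ne_zero.2 (pow_ne_zero _ ((_root_.map_ne_zero _).2 hμ0)), ?_⟩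
    have hcont : ContinuousAt (fun w : ℂ × ℂ => (c * (w.1 * w.2)).re) (μ, μ) := by fun_prop
    have hval : (c * (μ * μ)).re = 1 := by
      have h1 : μ * (starRingEnd ℂ) μ = 1 := by rw [Complex.mul_conj']; simp [hμ]
      have : c * (μ * μ) = 1 := by
        rw [hc]; linear_combination (μ * (starRingEnd ℂ) μ + 1) * h1
      rw [this, Complex.one_re]
    have hev : ∀ᶠ w : ℂ × ℂ in 𝓝 μ ×ˢ 𝓝 μ, 1 / 2 < (c * (w.1 * w.2)).re := by
      rw [← nhds_prod_eq]
      refine hcont.tendsto.eventually_const_lt ?_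
      simp only [hval]
      norm_num
    filter_upwards [h.prod_inl _, hev.prod_inr _] with w h1 h2 hx hy
    rw [sub_sq_of_norm_eq_one (h1 _ hx) (h1 _ hy)]
    have h3 : -c * (-(w.2.1 * w.2.2) * ((‖w.2.1 - w.2.2‖ ^ 2 : ℝ) : ℂ)) =
        ((‖w.2.1 - w.2.2‖ ^ 2 : ℝ) : ℂ) * (c * (w.2.1 * w.2.2)) := by ring
    rw [h3, norm_mul, Complex.re_ofReal_mul, norm_mul, norm_mul, hcn, h1 _ hx, h1 _ hy,
      Complex.norm_real, Real.norm_of_nonneg (sq_nonneg _)]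
    nlinarith [sq_nonneg ‖w.2.1 - w.2.2‖]
  · refine ⟨1, one_ne_zero, ?_⟩
    have hev : ∀ᶠ x in 𝓝 μ, ‖x‖ ≠ 1 := continuous_norm.continuousAt.eventually_ne hμ
    filter_upwards [h.prod_inl _, (hev.prod_inl (𝓝 μ)).prod_inr _] with w h1 h2 hx
    exact absurd (h1 _ hx) h2

/-! ### Continuous choices of an eigenvalue. -/

/-- A continuous choice among finitely many analytic functions of `√ε` follows one of them. -/
lemma exists_eq_of_continuousOn {κ : Type*} [Finite κ] {h : κ → ℂ → ℂ}
    (hh : ∀ k, AnalyticAt ℂ (h k) 0) {f : ℝ → ℂ} {δ η : ℝ} (hδ : 0 < δ) (hη : 0 < η)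
    (hf : ContinuousOn f (Set.Icc 0 η))
    (hex : ∀ ε : ℝ, 0 < ε → ε < δ → ε ≤ η → ∃ k, f ε = h k (Real.sqrt ε : ℝ)) :
    ∃ δ' : ℝ, 0 < δ' ∧ δ' ≤ δ ∧ δ' ≤ η ∧
      ∃ k, ∀ ε : ℝ, 0 ≤ ε → ε < δ' → f ε = h k (Real.sqrt ε : ℝ) := by
  have hpair : ∀ᶠ s in 𝓝 0, s ≠ 0 → ∀ k l, h k s = h l s → ∀ᶠ s in 𝓝 0, h k s = h l s := by
    suffices H : ∀ᶠ s in 𝓝[≠] 0, ∀ k l, h k s = h l s → ∀ᶠ s in 𝓝 0, h k s = h l s from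
      eventually_nhdsWithin_iff.1 H
    rw [eventually_all]
    intro k
    rw [eventually_all]
    intro l
    rcases (hh k).eventually_eq_or_eventually_ne (hh l) with h1 | h1
    · exact Eventually.of_forall fun s _ => h1
    · exact h1.mono fun s hs hs' => absurd hs' hs
  have hall : ∀ᶠ s in 𝓝 0, (∀ k, ContinuousAt (h k) s) ∧
      (∀ k l, (∀ᶠ s in 𝓝 0, h k s = h l s) → h k s = h l s) := by
    refine Eventually.and ?_ ?_
    · rw [eventually_all]
      exact fun k => (hh k).eventually_analyticAt.mono fun s hs => hs.continuousAt
    · rw [eventually_all]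
      intro k
      rw [eventually_all]
      intro l
      by_cases h1 : ∀ᶠ s in 𝓝 0, h k s = h l s
      · exact h1.mono fun s hs _ => hs
      · exact Eventually.of_forall fun s h2 => absurd h2 h1
  obtain ⟨ρ, hρ, hball⟩ := Metric.eventually_nhds_iff.1 (hpair.and hall)
  set δ' := min (min δ η) (ρ ^ 2) with hδ'
  have hδ'0 : 0 < δ' := lt_min (lt_min hδ hη) (by positivity)
  have hsq : ∀ ε : ℝ, 0 ≤ ε → ε < δ' → dist ((Real.sqrt ε : ℝ) : ℂ) 0 < ρ := by
    intro ε h0 h1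
    rw [dist_zero_right, Complex.norm_real, Real.norm_of_nonneg (Real.sqrt_nonneg _),
      Real.sqrt_lt' hρ]
    exact h1.trans_le (min_le_right _ _)
  have hδδ : δ' ≤ δ := (min_le_left _ _).trans (min_le_left _ _)
  have hδη : δ' ≤ η := (min_le_left _ _).trans (min_le_right _ _)
  refine ⟨δ', hδ'0, hδδ, hδη, ?_⟩
  have hcontf : Continuous (fun x : Set.Ioo 0 δ' => f x) :=
    continuousOn_iff_continuous_domRestrict.1
      (hf.mono fun x hx => ⟨hx.1.le, hx.2.le.trans hδη⟩)
  have hconth : ∀ k, Continuous (fun x : Set.Ioo 0 δ' => h k (Real.sqrt x : ℝ)) := by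
    intro k
    rw [continuous_iff_continuousAt]
    intro x
    refine ContinuousAt.comp (g := h k) (f := fun x : Set.Ioo 0 δ' => ((Real.sqrt x : ℝ) : ℂ))
      ((hball (hsq x x.2.1.le x.2.2)).2.1 k) ?_
    fun_prop
  have hex' : ∀ x : Set.Ioo 0 δ', ∃ k, f x = h k (Real.sqrt x : ℝ) := fun x =>
    hex x x.2.1 (x.2.2.trans_le hδδ) (x.2.2.le.trans hδη)
  have : Nonempty (Set.Ioo 0 δ') := ⟨⟨δ' / 2, by constructor <;> linarith⟩⟩
  have hpre : PreconnectedSpace (Set.Ioo 0 δ') :=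
    isPreconnected_iff_preconnectedSpace.1 isPreconnected_Ioo
  obtain ⟨x₀⟩ := this
  obtain ⟨k, hk⟩ := hex' x₀
  have hclosed : ∀ l, IsClosed {x : Set.Ioo 0 δ' | f x = h l (Real.sqrt x : ℝ)} := fun l =>
    isClosed_eq hcontf (hconth l)
  -- Different branches never meet on the open interval, so the complement of one coincidence set is
  -- a finite union of closed ones. The set is then clopen, and connectedness makes it everything.
  have hcompl : {x : Set.Ioo 0 δ' | f x = h k (Real.sqrt x : ℝ)}ᶜ =
      ⋃ l ∈ {l | ¬ ∀ᶠ s in 𝓝 0, h k s = h l s},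
        {x : Set.Ioo 0 δ' | f x = h l (Real.sqrt x : ℝ)} := by
    ext x
    simp only [Set.mem_compl_iff, Set.mem_ofPred_eq, Set.mem_iUnion, exists_prop]
    have hx := hball (hsq x x.2.1.le x.2.2)
    have hx0 : ((Real.sqrt x : ℝ) : ℂ) ≠ 0 := by
      exact_mod_cast (Real.sqrt_pos.2 x.2.1).ne'
    constructor
    · intro h1
      obtain ⟨l, hl⟩ := hex' x
      refine ⟨l, fun h2 => h1 ?_, hl⟩
      rw [hl, hx.2.2 k l h2]
    · rintro ⟨l, h1, hl⟩ h2
      exact h1 (hx.1 hx0 k l (h2.symm.trans hl))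
  have hclopen : IsClopen {x : Set.Ioo 0 δ' | f x = h k (Real.sqrt x : ℝ)} := by
    refine ⟨hclosed k, ?_⟩
    rw [← isClosed_compl_iff, hcompl]
    exact (Set.toFinite _).isClosed_biUnion fun l _ => hclosed l
  have huniv := hclopen.eq_univ ⟨x₀, hk⟩
  have hpos : ∀ ε : ℝ, 0 < ε → ε < δ' → f ε = h k (Real.sqrt ε : ℝ) := fun ε h0 h1 => by
    have : (⟨ε, h0, h1⟩ : Set.Ioo 0 δ') ∈ {x : Set.Ioo 0 δ' | f x = h k (Real.sqrt x : ℝ)} := by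
      rw [huniv]; trivial
    exact this
  refine ⟨k, fun ε h0 h1 => ?_⟩
  -- All branches may meet at `ε = 0`; there the equality follows by continuity from the right.
  rcases h0.eq_or_lt with rfl | h0
  · have hf0 : Tendsto f (𝓝[>] 0) (𝓝 (f 0)) := by
      have h2 : Tendsto f (𝓝[Set.Icc 0 η] 0) (𝓝 (f 0)) := hf 0 ⟨le_rfl, hη.le⟩
      refine h2.mono_left ?_
      rw [← nhdsWithin_Ioo_eq_nhdsGT hη]
      exact nhdsWithin_mono _ Set.Ioo_subset_Icc_self
    have hh0 : Tendsto (fun ε : ℝ => h k (Real.sqrt ε : ℝ)) (𝓝[>] 0)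
        (𝓝 (h k (Real.sqrt 0 : ℝ))) := by
      have h3 : ContinuousAt (fun ε : ℝ => h k (Real.sqrt ε : ℝ)) 0 :=
        ContinuousAt.comp (g := h k) (f := fun ε : ℝ => ((Real.sqrt ε : ℝ) : ℂ))
          (by simpa using (hh k).continuousAt) (by fun_prop)
      exact h3.tendsto.mono_left nhdsWithin_le_nhds
    refine tendsto_nhds_unique (hf0.congr' ?_) hh0
    filter_upwards [Ioo_mem_nhdsGT hδ'0] with x hx
    exact hpos x hx.1 hx.2
  · exact hpos ε h0 h1

/-! ### The theorem for unitary families. -/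

section

variable {ι : Type*} [Fintype ι] [DecidableEq ι]

open scoped Matrix.Norms.L2Operator in
lemma Matrix.norm_eq_one_of_isRoot_charpoly {A : Matrix ι ι ℂ}
    (hA : A ∈ Matrix.unitaryGroup ι ℂ) {x : ℂ} (hx : A.charpoly.IsRoot x) : ‖x‖ = 1 :=
  spectrum.norm_eq_one_of_unitary hA (Matrix.mem_spectrum_iff_isRoot_charpoly.2 hx)

/-- The characteristic polynomials in the variable `s = √ε`. -/
lemma exists_isAnalyticFamily_charpoly {U : ℝ → Matrix ι ι ℂ} (hP : HasPolynomialCharpoly U) :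
    ∃ F : ℂ → ℂ[X], IsAnalyticFamily (Fintype.card ι) F ∧ (∀ s, F (-s) = F s) ∧
      ∀ s : ℝ, s ^ 2 ≤ 1 / 2 → F s = (U (s ^ 2)).charpoly := by
  obtain ⟨P, hP⟩ := hP
  -- Degree and leading coefficient of `P` are known only for `ε` in `[0, 1/2]`. Infinitely many
  -- values determine a polynomial in `ε`, so `P` itself is monic of the right degree.
  have hzero : ∀ p q : ℂ[X], (∀ ε : ℝ, 0 ≤ ε → ε ≤ 1 / 2 → p.eval (ε : ℂ) = q.eval (ε : ℂ)) →
      p = q := by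
    intro p q h
    refine eq_of_infinite_eval_eq p q (Set.Infinite.mono ?_
      ((Set.Icc_infinite (show (0 : ℝ) < 1 / 2 by norm_num)).image
        Complex.ofReal_injective.injOn))
    rintro _ ⟨ε, hε, rfl⟩
    exact h ε hε.1 hε.2
  have hcoeff : ∀ k, ∀ ε : ℝ, 0 ≤ ε → ε ≤ 1 / 2 →
      (P.coeff k).eval (ε : ℂ) = (U ε).charpoly.coeff k := by
    intro k ε h0 h1
    rw [hP ε h0 h1, coeff_map]
    rfl
  have htop : P.coeff (Fintype.card ι) = 1 := by
    refine hzero _ _ fun ε h0 h1 => ?_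
    rw [hcoeff _ ε h0 h1, eval_one]
    have := (U ε).charpoly_monic.coeff_natDegree
    rwa [Matrix.charpoly_natDegree_eq_dim] at this
  have hdeg : P.natDegree ≤ Fintype.card ι := by
    rw [natDegree_le_iff_coeff_eq_zero]
    intro k hk
    refine hzero _ _ fun ε h0 h1 => ?_
    rw [hcoeff _ ε h0 h1, eval_zero]
    exact coeff_eq_zero_of_natDegree_lt (by rwa [Matrix.charpoly_natDegree_eq_dim])
  have hmonic : P.Monic := monic_of_natDegree_le_of_coeff_eq_one _ hdeg htop
  have hnat : P.natDegree = Fintype.card ι :=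
    le_antisymm hdeg (le_natDegree_of_ne_zero (by rw [htop]; exact one_ne_zero))
  refine ⟨fun s => P.map (evalRingHom (s ^ 2)), ⟨fun s => hmonic.map _, fun s => ?_, fun k => ?_⟩,
    fun s => by simp only [neg_sq], fun s hs => ?_⟩
  · rw [hmonic.natDegree_map, hnat]
  · simp only [coeff_map, coe_evalRingHom]
    refine Differentiable.analyticAt ?_ 0
    exact (P.coeff k).differentiable.comp (differentiable_id.pow 2)
  · rw [hP _ (sq_nonneg s) hs]
    push_cast
    rfl

lemma exists_radius {Q : ℂ → Prop} (h : ∀ᶠ s in 𝓝 0, Q s) :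
    ∃ δ : ℝ, 0 < δ ∧ δ ≤ 1 / 2 ∧
      ∀ ε : ℝ, 0 ≤ ε → ε < δ → ∀ s : ℂ, ‖s‖ = Real.sqrt ε → Q s := by
  obtain ⟨ρ, hρ, hQ⟩ := Metric.eventually_nhds_iff.1 h
  refine ⟨min (1 / 2) (ρ ^ 2), lt_min (by norm_num) (by positivity), min_le_left _ _,
    fun ε h0 h1 s hs => hQ ?_⟩
  rw [dist_zero_right, hs, Real.sqrt_lt' hρ]
  exact h1.trans_le (min_le_right _ _)

lemma Multiset.prod_map_eq_prod_get {α β : Type*} [CommMonoid β] (M : Multiset α) (f : α → β) :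
    (M.map f).prod = ∏ i : Fin M.toList.length, f (M.toList.get i) := by
  conv_lhs => rw [← Multiset.coe_toList M]
  rw [Multiset.map_coe, Multiset.prod_coe, ← Fin.prod_univ_fun_getElem]
  rfl

theorem eigenvaluesExpand_of_unitary {U : ℝ → Matrix ι ι ℂ}
    (hU : ∀ ε : ℝ, 0 ≤ ε → ε ≤ 1 / 2 → U ε ∈ Matrix.unitaryGroup ι ℂ)
    (hP : HasPolynomialCharpoly U) : EigenvaluesExpand U := by
  obtain ⟨F, hF, hFneg, hFU⟩ := exists_isAnalyticFamily_charpoly hP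
  have hcone : HasConeRoots F := by
    refine hasConeRoots_of_norm_eq_one ?_
    rw [realPunctured, eventually_map]
    have hc : ∀ᶠ t : ℝ in 𝓝 0, t ^ 2 < 1 / 2 :=
      (continuous_pow 2).continuousAt.tendsto.eventually_lt_const (by norm_num)
    filter_upwards [hc.filter_mono nhdsWithin_le_nhds] with t ht x hx
    rw [hFU t ht.le] at hx
    exact Matrix.norm_eq_one_of_isRoot_charpoly (hU _ (sq_nonneg t) ht.le) hx
  obtain ⟨L, hL, hFL⟩ := hF.splitsAnalytically hcone
  obtain ⟨M, N, hM, hN, hMN⟩ := exists_even_and_pairs L hL (by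
    filter_upwards [hFL, tendsto_neg_nhds_zero.eventually hFL] with s h1 h2
    rw [← h1, ← h2, hFneg])
  set u : Fin M.toList.length → ℂ → ℂ := fun i => M.toList.get i with hu
  set v : Fin N.toList.length → ℂ → ℂ := fun i => N.toList.get i with hv
  replace hM : ∀ i, AnalyticAt ℂ (u i) 0 ∧ ∀ᶠ s in 𝓝 0, u i (-s) = u i s := fun i =>
    hM _ (Multiset.mem_toList.1 (List.get_mem _ _))
  replace hN : ∀ i, AnalyticAt ℂ (v i) 0 ∧ ¬ ∀ᶠ s in 𝓝 0, v i (-s) = v i s := fun i =>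
    hN _ (Multiset.mem_toList.1 (List.get_mem _ _))
  choose A hA using fun i => (hM i).1.exists_hasSum_sq (hM i).2
  choose B hB using fun i => (hN i).1.exists_hasSum
  have hfac : ∀ᶠ s in 𝓝 0, F s = (∏ i, (X - C (u i s))) *
      ∏ i, ((X - C (v i s)) * (X - C (v i (-s)))) := by
    filter_upwards [hFL, hMN] with s h1 h2
    rw [h1, h2, Multiset.prod_map_eq_prod_get, Multiset.prod_map_eq_prod_get]
  obtain ⟨δ, hδ, hδ2, hev⟩ := exists_radius ((eventually_all.2 hA).and ((eventually_all.2 hB).and hfac))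
  have hnorm : ∀ ε : ℝ, ‖((Real.sqrt ε : ℝ) : ℂ)‖ = Real.sqrt ε := fun ε => by
    rw [Complex.norm_real, Real.norm_of_nonneg (Real.sqrt_nonneg _)]
  have hnorm' : ∀ (ε : ℝ) (k : Fin 2), ‖(-1 : ℂ) ^ (k : ℕ) * ((Real.sqrt ε : ℝ) : ℂ)‖ =
      Real.sqrt ε := fun ε k => by
    rw [norm_mul, norm_pow, norm_neg, norm_one, one_pow, one_mul, hnorm]
  have hcomplete : ∀ ε : ℝ, 0 ≤ ε → ε < δ → (U ε).charpoly =
      (∏ i, (X - C (u i (Real.sqrt ε : ℝ)))) *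
        ∏ i, ∏ k : Fin 2, (X - C (v i ((-1) ^ (k : ℕ) * (Real.sqrt ε : ℝ)))) := by
    intro ε h0 h1
    have h2 := (hev ε h0 h1 _ (hnorm ε)).2.2
    rw [hFU _ (by rw [Real.sq_sqrt h0]; linarith), Real.sq_sqrt h0] at h2
    rw [h2]
    simp
  refine ⟨δ, hδ, hδ2, _, _, A, fun i ε => u i (Real.sqrt ε : ℝ), B,
    fun i k ε => v i ((-1) ^ (k : ℕ) * (Real.sqrt ε : ℝ)), ?_, ?_, ?_, ?_, hcomplete, ?_⟩
  · intro i ε h0 h1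
    have h2 := (hev ε h0 h1 _ (hnorm ε)).1 i
    rwa [← Complex.ofReal_pow, Real.sq_sqrt h0] at h2
  · intro i k ε h0 h1
    have h2 := (hev ε h0 h1 _ (hnorm' ε k)).2.1 i
    have h3 : (fun j : ℕ => (-1 : ℂ) ^ ((k : ℕ) * j) * B i j * ((Real.sqrt ε : ℝ) : ℂ) ^ j) =
        fun j => B i j * ((-1 : ℂ) ^ (k : ℕ) * ((Real.sqrt ε : ℝ) : ℂ)) ^ j := by
      funext j
      rw [mul_pow, ← pow_mul]
      ring
    rw [h3]
    exact h2
  -- If all odd coefficients vanished, `v i` would be even, contrary to its choice.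
  · intro i
    by_contra! hcon
    refine (hN i).2 ?_
    filter_upwards [hB i, tendsto_neg_nhds_zero.eventually (hB i)] with s h1 h2
    refine h2.unique ?_
    have h3 : (fun j => B i j * (-s) ^ j) = fun j => B i j * s ^ j := by
      funext j
      rcases Nat.even_or_odd j with hj | hj
      · rw [hj.neg_pow]
      · rw [hcon j hj, zero_mul, zero_mul]
    rw [h3]
    exact h1
  -- At `ε = 0` both members of the pair equal `v i 0`, so the square of a linear factor divides the
  -- characteristic polynomial.
  · intro i k
    rw [le_rootMultiplicity_iff (U 0).charpoly_monic.ne_zero, hcomplete 0 le_rfl hδ]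
    refine Dvd.dvd.mul_left ?_ _
    refine Dvd.dvd.trans ?_ (Finset.dvd_prod_of_mem _ (Finset.mem_univ i))
    simp [sq]
  · intro η f hη hη2 hf heig
    obtain ⟨δ', h1, h2, h3, k, hk⟩ := exists_eq_of_continuousOn
      (κ := Fin M.toList.length ⊕ Fin N.toList.length × Fin 2)
      (h := Sum.elim u (fun ik s => v ik.1 ((-1) ^ (ik.2 : ℕ) * s))) (by
        rintro (i | ⟨i, k⟩)
        · exact (hM i).1
        · exact AnalyticAt.comp (g := v i) (by simpa using (hN i).1)
            (analyticAt_const.mul analyticAt_id)) hδ hη hf (by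
        intro ε h0 h1 h2
        have h3 := heig ε ⟨h0.le, h2⟩
        rw [Module.End.hasEigenvalue_iff_isRoot_charpoly, Matrix.charpoly_toLin',
          hcomplete ε h0.le h1, IsRoot.def, eval_mul, mul_eq_zero, eval_prod, eval_prod,
          Finset.prod_eq_zero_iff, Finset.prod_eq_zero_iff] at h3
        rcases h3 with ⟨i, -, hi⟩ | ⟨i, -, hi⟩
        · exact ⟨Sum.inl i, by simpa [sub_eq_zero] using hi⟩
        · rw [eval_prod, Finset.prod_eq_zero_iff] at hi
          obtain ⟨k, -, hk⟩ := hi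
          exact ⟨Sum.inr (i, k), by simpa [sub_eq_zero] using hk⟩)
    refine ⟨δ', h1, h2, h3, ?_⟩
    rcases k with i | ⟨i, k⟩
    · exact Or.inl ⟨i, hk⟩
    · exact Or.inr ⟨i, k, hk⟩

end

/-! ### The walk on the star. -/

lemma StarArc.sum_eq {L D : Type*} [Fintype L] [Fintype D] {R : Type*} [AddCommMonoid R]
    (f : StarArc L D → R) :
    ∑ x, f x = ∑ j, f (.inn j) + (∑ j, f (.out j) + (f .toG + (f .fromG + ∑ d, f (.dart d)))) := by
  let e : L ⊕ L ⊕ Unit ⊕ Unit ⊕ D ≃ StarArc L D :=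
    { toFun := Sum.elim .inn (Sum.elim .out (Sum.elim (fun _ => .toG)
        (Sum.elim (fun _ => .fromG) .dart)))
      invFun := fun x => match x with
        | .inn j => .inl j
        | .out j => .inr (.inl j)
        | .toG => .inr (.inr (.inl ()))
        | .fromG => .inr (.inr (.inr (.inl ())))
        | .dart d => .inr (.inr (.inr (.inr d)))
      left_inv := by rintro (_ | _ | _ | _ | _) <;> rfl
      right_inv := by rintro (_ | _ | _ | _ | _) <;> rfl }
  rw [← e.sum_comp]
  simp [Fintype.sum_sum_type, e]

/-- A step consists of three unitary blocks with disjoint inputs and disjoint outputs: `H`, the leaf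
phase and `S`. -/
lemma starStep_mem_unitaryGroup {L D : Type*} [Fintype L] [DecidableEq L] [Fintype D]
    [DecidableEq D] {H : Matrix (Option L) (Option L) ℂ} {S : Matrix (Option D) (Option D) ℂ}
    (hH : H ∈ Matrix.unitaryGroup (Option L) ℂ) (hS : S ∈ Matrix.unitaryGroup (Option D) ℂ)
    (φ : ℝ) : starStep H φ S ∈ Matrix.unitaryGroup (StarArc L D) ℂ := by
  rw [Matrix.mem_unitaryGroup_iff'] at hH hS ⊢
  have hexp : (starRingEnd ℂ) (Complex.exp (Complex.I * φ)) * Complex.exp (Complex.I * φ) = 1 := by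
    rw [← Complex.exp_conj, ← Complex.exp_add]
    simp
  have hH' := fun i j => congrFun (congrFun hH i) j
  have hS' := fun i j => congrFun (congrFun hS i) j
  simp only [Matrix.mul_apply, Matrix.star_apply, Matrix.one_apply, Fintype.sum_option,
    RCLike.star_def] at hH' hS'
  ext i j
  rw [Matrix.mul_apply, StarArc.sum_eq, Matrix.one_apply]
  simp only [Matrix.star_apply, RCLike.star_def]
  have hH'' : ∀ i j, ∑ k, (starRingEnd ℂ) (H (some k) i) * H (some k) j +
      (starRingEnd ℂ) (H none i) * H none j = if i = j then 1 else 0 := fun i j => by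
    rw [add_comm]; exact hH' i j
  rcases i with i | i | _ | _ | i <;> rcases j with j | j | _ | _ | j <;>
    simp [starStep, apply_ite (starRingEnd ℂ), hexp, hH'', hS', eq_comm]

lemma groverHub_apply (m : ℕ) (k j : Option (Fin m)) :
    groverHub m k j = 2 / ((m : ℂ) + 1) - if k = j then 1 else 0 := by
  unfold groverHub
  split_ifs <;> ring

lemma reducedHub_mem_unitaryGroup {ε : ℝ} (h0 : 0 ≤ ε) (h1 : ε ≤ 1 / 2) :
    reducedHub ε ∈ Matrix.unitaryGroup (Option Unit) ℂ := by
  have h2 : Real.sqrt (ε - ε ^ 2) * Real.sqrt (ε - ε ^ 2) = ε - ε ^ 2 :=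
    Real.mul_self_sqrt (by nlinarith)
  have h3 : ((Real.sqrt (ε - ε ^ 2) : ℝ) : ℂ) * ((Real.sqrt (ε - ε ^ 2) : ℝ) : ℂ) = ε - ε ^ 2 := by
    rw [← Complex.ofReal_mul, h2]; push_cast; rfl
  rw [Matrix.mem_unitaryGroup_iff']
  ext i j
  rw [Matrix.mul_apply, Fintype.sum_option, Matrix.one_apply]
  rcases i with _ | _ <;> rcases j with _ | _ <;>
    simp [reducedHub, Matrix.star_apply] <;>
    first | ring1 | linear_combination 4 * h3

lemma symmetricEmbedding_isometry {m : ℕ} (hm : 1 ≤ m) (D : Type*) [Fintype D] [DecidableEq D] :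
    (symmetricEmbedding m D)ᴴ * symmetricEmbedding m D = 1 := by
  have h1 : (m : ℂ) * (((Real.sqrt m : ℝ) : ℂ)⁻¹ * ((Real.sqrt m : ℝ) : ℂ)⁻¹) = 1 := by
    have hm' : (m : ℂ) ≠ 0 := by exact_mod_cast (by omega : m ≠ 0)
    rw [← mul_inv, ← Complex.ofReal_mul, Real.mul_self_sqrt (Nat.cast_nonneg m)]
    simp [hm']
  ext i j
  rw [Matrix.mul_apply, StarArc.sum_eq, Matrix.one_apply]
  rcases i with i | i | _ | _ | i <;> rcases j with j | j | _ | _ | j <;>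
    simp [symmetricEmbedding, Matrix.conjTranspose_apply, h1, eq_comm]

lemma starStep_groverHub_mul_symmetricEmbedding {m : ℕ} (hm : 1 ≤ m) {D : Type*} [Fintype D]
    [DecidableEq D] (φ : ℝ) (S : Matrix (Option D) (Option D) ℂ) :
    starStep (groverHub m) φ S * symmetricEmbedding m D =
      symmetricEmbedding m D * starStep (reducedHub (1 / ((m : ℝ) + 1))) φ S := by
  have hr : ((Real.sqrt m : ℝ) : ℂ) * (Real.sqrt m : ℝ) = m := by
    rw [← Complex.ofReal_mul, Real.mul_self_sqrt (Nat.cast_nonneg m)]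
    simp
  have hr0 : ((Real.sqrt m : ℝ) : ℂ) ≠ 0 := by
    have : (0 : ℝ) < m := by exact_mod_cast hm
    exact_mod_cast (Real.sqrt_pos.2 this).ne'
  have hm1 : (m : ℂ) + 1 ≠ 0 := by exact_mod_cast Nat.succ_ne_zero m
  -- For `ε = 1 / (m + 1)` one has `ε - ε ^ 2 = m / (m + 1) ^ 2`; the `√m` matches the normalisation
  -- of `|in⟩` and `|out⟩`.
  have hsqrt : ((Real.sqrt (((m : ℝ) + 1)⁻¹ - (((m : ℝ) + 1) ^ 2)⁻¹) : ℝ) : ℂ) =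
      (Real.sqrt m : ℝ) / ((m : ℂ) + 1) := by
    have h1 : ((m : ℝ) + 1)⁻¹ - (((m : ℝ) + 1) ^ 2)⁻¹ = m / ((m : ℝ) + 1) ^ 2 := by
      field_simp
      ring
    rw [h1, Real.sqrt_div' _ (by positivity), Real.sqrt_sq (by positivity)]
    push_cast
    rfl
  ext i j
  rw [Matrix.mul_apply, Matrix.mul_apply, StarArc.sum_eq, StarArc.sum_eq]
  rcases i with i | i | _ | _ | i <;> rcases j with j | j | _ | _ | j <;>
    simp [symmetricEmbedding, starStep, reducedHub, groverHub_apply, hsqrt]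
  case inn.out => exact mul_comm _ _
  case out.inn =>
    rw [← Finset.sum_mul, Finset.sum_sub_distrib]
    simp
    field_simp
    ring
  case out.fromG => field_simp
  case toG.inn =>
    field_simp
    rw [sq, hr]
  case toG.fromG => ring

/-! ### Polynomial dependence of the characteristic polynomial on `ε`. -/

/-- The hub after the change of basis that scales `|in⟩` and `|out⟩` by `2√(ε - ε²)`. -/
def rationalHub (ε : ℂ) : Matrix (Option Unit) (Option Unit) ℂ
  | some _, some _ => 1 - 2 * ε
  | none, some _ => 1
  | some _, none => 4 * (ε - ε ^ 2)
  | none, none => -(1 - 2 * ε)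

lemma exists_polynomial_starStep_rationalHub {D : Type*} (φ : ℝ)
    (S : Matrix (Option D) (Option D) ℂ) (i j : StarArc Unit D) :
    ∃ p : ℂ[X], ∀ ε : ℂ, p.eval ε = starStep (rationalHub ε) φ S i j := by
  have hconst : ∀ c : ℂ, ∃ p : ℂ[X], ∀ ε : ℂ, p.eval ε = c := fun c => ⟨C c, by simp⟩
  rcases i with i | i | _ | _ | i <;> rcases j with j | j | _ | _ | j
  case out.inn => exact ⟨1 - 2 * X, by simp [starStep, rationalHub]⟩
  case out.fromG => exact ⟨4 * (X - X ^ 2), by simp [starStep, rationalHub]⟩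
  case toG.fromG => exact ⟨-(1 - 2 * X), by simp [starStep, rationalHub]⟩
  all_goals exact hconst _

section

variable {D : Type*} [Fintype D] [DecidableEq D] (φ : ℝ) (S : Matrix (Option D) (Option D) ℂ)

/-- Conjugation by a diagonal matrix. Scaling `|in⟩` and `|out⟩` equally leaves the leaf phase
unchanged and turns the two hub entries `y`, `y` into `1`, `y ^ 2`. -/
lemma charpoly_starStep_reducedHub_of_pos {ε : ℝ} (h0 : 0 < ε) (h1 : ε ≤ 1 / 2) :
    (starStep (reducedHub ε) φ S).charpoly = (starStep (rationalHub ε) φ S).charpoly := by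
  have hpos : 0 < ε - ε ^ 2 := by nlinarith
  set y : ℂ := ((2 * Real.sqrt (ε - ε ^ 2) : ℝ) : ℂ) with hy
  have hy0 : y ≠ 0 := by
    rw [hy]
    exact_mod_cast (mul_pos two_pos (Real.sqrt_pos.2 hpos)).ne'
  have hyy : y * y = 4 * (ε - ε ^ 2) := by
    rw [hy, ← Complex.ofReal_mul]
    have : 2 * Real.sqrt (ε - ε ^ 2) * (2 * Real.sqrt (ε - ε ^ 2)) = 4 * (ε - ε ^ 2) := by
      linear_combination 4 * Real.mul_self_sqrt hpos.le
    rw [this]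
    push_cast
    rfl
  let w : StarArc Unit D → ℂ := fun x => match x with
    | .inn _ => y
    | .out _ => y
    | _ => 1
  have hw : IsUnit (Matrix.diagonal w) := by
    rw [Matrix.isUnit_diagonal, Pi.isUnit_iff]
    rintro (_ | _ | _ | _ | _) <;> simp [w, hy0]
  obtain ⟨W, hW⟩ := hw
  have hconj : W.val * starStep (reducedHub ε) φ S = starStep (rationalHub ε) φ S * W.val := by
    rw [hW]
    ext i j
    rw [Matrix.diagonal_mul, Matrix.mul_diagonal]
    rcases i with i | i | _ | _ | i <;> rcases j with j | j | _ | _ | j <;>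
      simp [starStep, reducedHub, rationalHub, w, mul_comm, ← hyy, hy]
  rw [← Matrix.charpoly_units_conj W, hconj, mul_assoc, ← Matrix.coe_units_inv,
    Units.mul_inv, mul_one]

lemma continuous_eval_charpoly {ι : Type*} [Fintype ι] [DecidableEq ι] {M : ℝ → Matrix ι ι ℂ}
    (hM : ∀ i j, Continuous fun ε => M ε i j) (x : ℂ) :
    Continuous fun ε => (M ε).charpoly.eval x := by
  simp only [Matrix.eval_charpoly]
  refine Continuous.matrix_det ?_
  exact continuous_const.sub (continuous_matrix hM)

lemma charpoly_starStep_reducedHub {ε : ℝ} (h0 : 0 ≤ ε) (h1 : ε ≤ 1 / 2) :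
    (starStep (reducedHub ε) φ S).charpoly = (starStep (rationalHub ε) φ S).charpoly := by
  rcases h0.eq_or_lt with rfl | h0
  swap
  · exact charpoly_starStep_reducedHub_of_pos φ S h0 h1
  -- At `ε = 0` the diagonal matrix is singular, so the identity is obtained as a limit from `ε >
  -- 0`.
  refine Polynomial.funext fun x => ?_
  have hl : Continuous fun ε : ℝ => (starStep (reducedHub ε) φ S).charpoly.eval x := by
    refine continuous_eval_charpoly (fun i j => ?_) x
    rcases i with i | i | _ | _ | i <;> rcases j with j | j | _ | _ | j <;>
      simp only [starStep, reducedHub] <;> fun_prop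
  have hr : Continuous fun ε : ℝ => (starStep (rationalHub ε) φ S).charpoly.eval x := by
    refine continuous_eval_charpoly (fun i j => ?_) x
    obtain ⟨p, hp⟩ := exists_polynomial_starStep_rationalHub φ S i j
    simp only [← hp]
    exact p.continuous.comp Complex.continuous_ofReal
  refine tendsto_nhds_unique (l := 𝓝[>] (0 : ℝ)) ((hl.tendsto 0).mono_left nhdsWithin_le_nhds)
    (((hr.tendsto 0).mono_left nhdsWithin_le_nhds).congr' ?_)
  filter_upwards [Ioo_mem_nhdsGT (show (0 : ℝ) < 1 / 2 by norm_num)] with ε hε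
  rw [charpoly_starStep_reducedHub_of_pos φ S hε.1 hε.2.le]

lemma hasPolynomialCharpoly_starStep :
    HasPolynomialCharpoly fun ε => starStep (reducedHub ε) φ S := by
  choose p hp using exists_polynomial_starStep_rationalHub φ S
  refine ⟨(Matrix.of p).charpoly, fun ε h0 h1 => ?_⟩
  rw [charpoly_starStep_reducedHub φ S h0 h1, ← Matrix.charpoly_map]
  congr 1
  ext i j
  simp [hp]

end

end

theorem theorem1 :
    -- any family of walk matrices, unitary for `0 ≤ ε ≤ 1/2`, whose characteristic polynomial is
    -- a polynomial in both variables
    (∀ (ι : Type*) [Fintype ι] [DecidableEq ι] (U : ℝ → Matrix ι ι ℂ),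
      (∀ ε : ℝ, 0 ≤ ε → ε ≤ 1 / 2 → U ε ∈ Matrix.unitaryGroup ι ℂ) →
      HasPolynomialCharpoly U →
      EigenvaluesExpand U) ∧
    -- in particular the walk on the star graph to which a graph `G` is attached
    (∀ (V : Type*) [Fintype V] [DecidableEq V] (G : SimpleGraph V) [DecidableRel G.Adj] (v₁ : V)
      (W : Scattering G v₁) (φ : ℝ),
      (∀ m : ℕ, 1 ≤ m →
        (symmetricEmbedding m G.Dart)ᴴ * symmetricEmbedding m G.Dart = 1 ∧
        fullWalk W φ m * symmetricEmbedding m G.Dart =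
          symmetricEmbedding m G.Dart * walkMatrix W φ (1 / ((m : ℝ) + 1))) ∧
      (∀ ε : ℝ, 0 ≤ ε → ε ≤ 1 / 2 →
        walkMatrix W φ ε ∈ Matrix.unitaryGroup (StarArc Unit G.Dart) ℂ) ∧
      HasPolynomialCharpoly (walkMatrix W φ) ∧
      EigenvaluesExpand (walkMatrix W φ)) := by
  refine ⟨fun ι _ _ U hU hP => eigenvaluesExpand_of_unitary hU hP, ?_⟩
  intro V _ _ G _ v₁ W φ
  have hunit : ∀ ε : ℝ, 0 ≤ ε → ε ≤ 1 / 2 →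
      walkMatrix W φ ε ∈ Matrix.unitaryGroup (StarArc Unit G.Dart) ℂ := fun ε h0 h1 =>
    starStep_mem_unitaryGroup (reducedHub_mem_unitaryGroup h0 h1) W.unitary φ
  have hpoly : HasPolynomialCharpoly (walkMatrix W φ) := hasPolynomialCharpoly_starStep φ W.S
  exact ⟨fun m hm => ⟨symmetricEmbedding_isometry hm G.Dart,
    starStep_groverHub_mul_symmetricEmbedding hm φ W.S⟩, hunit, hpoly,
    eigenvaluesExpand_of_unitary hunit hpoly⟩
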